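/- Fix $d\in\mathbb N$, $d\ge 1$, $\alpha\in[0,d)$ and $p\in[1,\infty]$. For an integer $m\ge 1$ put $n=m^d$ and let $\mathbb T_n^d=\mathbb Z^d/m\mathbb Z^d$ be the discrete $d$-dimensional torus with $n$ points (side length $m=n^{1/d}$), with torus $p$-norm $\|u\|:=\min\{\|x\|_p : x\in\mathbb Z^d \text{ a representative of } u\}$, where $\|\cdot\|_p$ is the $\ell^p$-norm on $\mathbb Z^d$. To each edge $e=\{u,v\}$ ($u\ne v$) of the complete graph on $\mathbb T_n^d$ assign the weight $T_e=\|e\|^\alpha E_e$, where $\|e\|=\|u-v\|$ and, for each $n$, the $(E_e)_e$ are i.i.d. exponential random variables of rate one. For $u,v\in\mathbb T_n^d$ let $$X_{u,v}=\min_{\pi}\sum_{e\in\pi}T_e,$$ the minimum being over all self-avoiding paths $\pi$ from $u$ to $v$ (so $X_{u,u}=0$), and let $$R_n=\sum_{u\in\mathbb T_n^d,\ u\ne 0}\|u\|^{-\alpha}.$$ Then, as $n=m^d\to\infty$ along the perfect $d$-th powers: 1. if $(U,V)=(U_n,V_n)$ is a uniformly random ordered pair of distinct vertices of $\mathbb T_n^d$,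 independent of the edge weights, then $X_{U,V}\,\dfrac{R_n}{\log n}\to 1$ in probability; 2. for every choice of deterministic vertices $u=u_n\in\mathbb T_n^d$, $\displaystyle\max_{v\in\mathbb T_n^d}X_{u,v}\,\frac{R_n}{\log n}\to 2$ in probability; 3. $\displaystyle\max_{u,v\in\mathbb T_n^d}X_{u,v}\,\frac{R_n}{\log n}\to 3$ in probability. -/

import Mathlib

open MeasureTheory ProbabilityTheory Filter
open scoped ENNReal

namespace LRFPP

noncomputable section

/-- The discrete `d`-dimensional torus of side length `m`, that is `ℤ^d` modulo `m ℤ^d`. It has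
`n = m ^ d` points. -/
abbrev Torus (d m : ℕ) : Type := Fin d → ZMod m

/-- The representatives in `ℤ^d` of a point of the torus. -/
abbrev Lift {d m : ℕ} (u : Torus d m) : Type :=
  {x : Fin d → ℤ // ∀ i, (x i : ZMod m) = u i}

/-- The `ℓ^p`-norm on `ℤ^d`, for `p ∈ [1, ∞]`. -/
def latticeNorm {d : ℕ} (p : ℝ≥0∞) (x : Fin d → ℤ) : ℝ :=
  ‖(WithLp.toLp p (fun i => (x i : ℝ)) : PiLp p (fun _ : Fin d => ℝ))‖

/-- The torus `p`-norm: the minimum of the `ℓ^p`-norms of the representatives of `u` in `ℤ^d`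
(the infimum is attained, since balls of `ℤ^d` are finite). -/
def torusNorm {d m : ℕ} (p : ℝ≥0∞) (u : Torus d m) : ℝ :=
  ⨅ x : Lift u, latticeNorm p x.1

theorem latticeNorm_neg {d : ℕ} (p : ℝ≥0∞) (x : Fin d → ℤ) :
    latticeNorm p (-x) = latticeNorm p x := by
  simp only [latticeNorm, norm, Pi.neg_apply, Int.cast_neg, abs_neg]

theorem torusNorm_neg {d m : ℕ} (p : ℝ≥0∞) (u : Torus d m) :
    torusNorm p (-u) = torusNorm p u := by
  let e : Lift (-u) ≃ Lift u :=
    { toFun := fun x => ⟨-x.1, fun i => by simp [x.2 i]⟩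
      invFun := fun x => ⟨-x.1, fun i => by simp [x.2 i]⟩
      left_inv := fun x => by simp
      right_inv := fun x => by simp }
  exact Equiv.iInf_congr e fun x => latticeNorm_neg p x.1

/-- Length `‖e‖` of an edge `e = {u, v}`: the torus `p`-norm of `u - v`. -/
def edgeLength {d m : ℕ} (p : ℝ≥0∞) : Sym2 (Torus d m) → ℝ :=
  Sym2.lift ⟨fun u v => torusNorm p (u - v), fun u v => by
    show torusNorm p (u - v) = torusNorm p (v - u)
    rw [← neg_sub v u, torusNorm_neg]⟩

/-- The complete graph on the torus. -/
abbrev graph (d m : ℕ) : SimpleGraph (Torus d m) := ⊤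

/-- The edge-weight `T_e = ‖e‖ ^ α * E_e`. -/
def edgeWeight {d m : ℕ} (p : ℝ≥0∞) (α : ℝ) (E : Sym2 (Torus d m) → ℝ)
    (e : Sym2 (Torus d m)) : ℝ :=
  edgeLength p e ^ α * E e

/-- The total weight of a walk. -/
def walkWeight {d m : ℕ} (T : Sym2 (Torus d m) → ℝ) {u v : Torus d m}
    (w : (graph d m).Walk u v) : ℝ :=
  (w.edges.map T).sum

/-- The transmission time `X_{u,v}`: the minimum over all self-avoiding paths from `u` to `v` (there
are finitely many, and at least one, when `m ≠ 0`) of the sum of the edge-weights along the path.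
For `u = v` the only such path has no edges, so that `X_{u,u} = 0`. -/
def transmissionTime {d m : ℕ} (T : Sym2 (Torus d m) → ℝ) (u v : Torus d m) : ℝ :=
  ⨅ π : (graph d m).Path u v, walkWeight T π.1

/-- The flooding time from `u`: the largest transmission time from `u` to a vertex. -/
def floodingTime {d m : ℕ} [NeZero m] (T : Sym2 (Torus d m) → ℝ) (u : Torus d m) : ℝ :=
  Finset.univ.sup' Finset.univ_nonempty fun v : Torus d m => transmissionTime T u v

/-- The (weighted) diameter: the largest transmission time between two vertices. -/
def diameter {d m : ℕ} [NeZero m] (T : Sym2 (Torus d m) → ℝ) : ℝ :=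
  Finset.univ.sup' Finset.univ_nonempty
    fun q : Torus d m × Torus d m => transmissionTime T q.1 q.2

/-- `R_n`, the sum of `‖u‖ ^ (-α)` over the nonzero points `u` of the torus with `n = m ^ d`
points. -/
def R (d m : ℕ) [NeZero m] (p : ℝ≥0∞) (α : ℝ) : ℝ :=
  ∑ u ∈ (Finset.univ : Finset (Torus d m)).erase 0, torusNorm p u ^ (-α)

/-- The scaling factor `R_n / log n` with `n = m ^ d`. -/
def scaling (d m : ℕ) [NeZero m] (p : ℝ≥0∞) (α : ℝ) : ℝ :=
  R d m p α / Real.log ((m : ℝ) ^ d)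

end

end LRFPP

namespace LRFPP

set_option linter.unusedSectionVars false

/-! Write n = m^d, R for the total rate of the edges at a vertex, and t_n = log n / R. The weight of
e is exponential of rate ‖e‖^(-α), so the set of vertices reached from u is a pure birth process:
when A has been reached, the next vertex arrives at rate Λ(A), the sum of the rates over the
boundary of A, and by memorylessness the other clocks then start afresh
(`lintegral_le_of_first_clock`, with the absorption lemmas for `fpp`). Always Λ(A) ≤ R |A|. As α <
d, small sets carry a negligible share of the rate at any vertex, so Λ(A) ≥ (1 - η) R |A| while |A|
≤ κ n (`exists_sum_rate_le`). Geometry enters only through these bounds and the sizes of R and of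
the smallest rate; otherwise the argument is mean-field.

Upper bounds. Grow clusters of order √n vertices around u and v; two disjoint ones are joined by
edges of total rate at least of order R. Multiplying the exponential moments of the successive
waiting times, at a parameter θ slightly below R, gives E exp(θ X_{u,v}) ≤ C n uniformly in u, v
(`exists_lintegral_exp_fpp_le`). Hence P(X_{u,v} ≥ (a + ε) t_n) ≤ C n^(1 - a - ε/2)
(`exists_upper_tail_le`). Taking a = 1, 2, 3 defeats an average over pairs, a union over n vertices
and a union over n² pairs.

Lower bounds. The mean number of vertices other than u within t of u is at most exp(τRt)/(τ - 1) for
every τ > 1 (`sum_measure_fpp_le`), hence o(n) for t = (1 - ε) t_n; this settles the typical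
distance. A vertex has no edge lighter than s = (1 - ε) t_n with probability exp(-sR), so there are
n^ε such isolated vertices on average, and this number concentrates: two vertices share one edge
only, which costs a factor exp(s) → 1 because t_n → 0. Taking s off the edges of isolated vertices
restores the original law, so an isolated endpoint adds s to a typical distance. One such endpoint
gives 2 (`flooding_lower_bound`), two give 3 (`diameter_lower_bound`). -/

/-! ### The exponential law. -/

theorem lintegral_expMeasure (r : ℝ) {f : ℝ → ℝ≥0∞} (hf : Measurable f) :
    ∫⁻ x, f x ∂expMeasure r = ∫⁻ x, exponentialPDF r x * f x := by
  have h : expMeasure r = volume.withDensity (exponentialPDF r) := rfl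
  have hm : Measurable (exponentialPDF r) := (measurable_exponentialPDFReal r).ennreal_ofReal
  rw [h, lintegral_withDensity_eq_lintegral_mul _ hm hf]
  rfl

/-- The exponential law is memoryless. -/
theorem expMeasure_restrict_Ici_map_sub (r : ℝ) {s : ℝ} (hs : 0 ≤ s) :
    ((expMeasure r).restrict (Set.Ici s)).map (fun x => x - s) =
      ENNReal.ofReal (Real.exp (-(s * r))) • expMeasure r := by
  refine Measure.ext_of_lintegral _ fun f hf => ?_
  have hfs : Measurable fun x : ℝ => f (x - s) := hf.comp (measurable_id.sub_const s)
  have hsub : Measurable fun x : ℝ => x - s := by fun_prop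
  rw [lintegral_map hf hsub, lintegral_smul_measure,
    ← lintegral_indicator measurableSet_Ici,
    lintegral_expMeasure r (hfs.indicator measurableSet_Ici),
    lintegral_expMeasure r hf, smul_eq_mul,
    ← lintegral_const_mul' _ _ ENNReal.ofReal_ne_top,
    ← lintegral_add_right_eq_self _ s]
  refine lintegral_congr fun x => ?_
  by_cases hx : 0 ≤ x
  · rw [Set.indicator_of_mem (by simpa using hx), exponentialPDF_of_nonneg hx,
      exponentialPDF_of_nonneg (by positivity), add_sub_cancel_right, ← mul_assoc,
      ← ENNReal.ofReal_mul (Real.exp_nonneg _)]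
    congr 2
    rw [mul_add, neg_add, Real.exp_add]
    ring_nf
  · rw [Set.indicator_of_notMem (by simpa using hx), exponentialPDF_of_neg (not_le.mp hx)]
    simp

theorem expMeasure_ae_nonneg (r : ℝ) : ∀ᵐ x ∂expMeasure r, 0 ≤ x := by
  have h : expMeasure r {x | ¬ 0 ≤ x} = 0 := by
    have hset : {x : ℝ | ¬ 0 ≤ x} = Set.Iio 0 := by ext x; simp
    rw [hset, ← lintegral_indicator_one measurableSet_Iio,
      lintegral_expMeasure r (measurable_one.indicator measurableSet_Iio)]
    refine (lintegral_congr fun x => ?_).trans lintegral_zero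
    by_cases hx : x < 0
    · rw [exponentialPDF_of_neg hx, zero_mul]
    · rw [Set.indicator_of_notMem (by simpa using hx), mul_zero]
  exact h

/-- The tilted density is a multiple of the exponential density of rate r - θ. Nothing is assumed on
the sign of θ: upper tails use θ > 0, the counting bound θ < 0. -/
theorem lintegral_exp_mul_expMeasure {r θ : ℝ} (hr : 0 < r) (hθ : θ < r) :
    ∫⁻ x, ENNReal.ofReal (Real.exp (θ * x)) ∂expMeasure r = ENNReal.ofReal (r / (r - θ)) := by
  have hd : 0 < r - θ := sub_pos.mpr hθ
  rw [lintegral_expMeasure r (by fun_prop),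
    ← mul_one (ENNReal.ofReal (r / (r - θ))), ← lintegral_exponentialPDF_eq_one hd,
    ← lintegral_const_mul' _ _ ENNReal.ofReal_ne_top]
  refine lintegral_congr fun x => ?_
  by_cases hx : 0 ≤ x
  · rw [exponentialPDF_of_nonneg hx, exponentialPDF_of_nonneg hx,
      ← ENNReal.ofReal_mul (by positivity), ← ENNReal.ofReal_mul (by positivity)]
    congr 1
    have : Real.exp (-((r - θ) * x)) = Real.exp (-(r * x)) * Real.exp (θ * x) := by
      rw [← Real.exp_add]; ring_nf
    rw [this]
    field_simp
  · rw [exponentialPDF_of_neg (not_le.mp hx), exponentialPDF_of_neg (not_le.mp hx)]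
    simp

/-- This turns ‖e‖^α E_e into a clock of rate ‖e‖^(-α). -/
theorem expMeasure_map_const_mul {c : ℝ} (hc : 0 < c) :
    (expMeasure 1).map (fun x => c * x) = expMeasure c⁻¹ := by
  have := isProbabilityMeasure_expMeasure one_pos
  have := isProbabilityMeasure_expMeasure (inv_pos.mpr hc)
  have hm : Measurable fun x : ℝ => c * x := by fun_prop
  have := Measure.isProbabilityMeasure_map (μ := expMeasure 1) hm.aemeasurable
  refine Measure.eq_of_cdf _ _ ?_
  ext x
  rw [cdf_expMeasure_eq (inv_pos.mpr hc), cdf_eq_real, map_measureReal_apply hm measurableSet_Iic]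
  have hset : (fun x => c * x) ⁻¹' Set.Iic x = Set.Iic (c⁻¹ * x) := by
    ext y
    simp only [Set.mem_preimage, Set.mem_Iic]
    rw [inv_mul_eq_div, le_div_iff₀ hc, mul_comm]
  rw [hset, ← cdf_eq_real, cdf_expMeasure_eq one_pos]
  have : 0 ≤ c⁻¹ * x ↔ 0 ≤ x := by
    rw [mul_nonneg_iff_of_pos_left (inv_pos.mpr hc)]
  simp only [this, one_mul]

theorem expMeasure_Iic_le {r : ℝ} (hr : 0 < r) (t : ℝ) (ht : 0 ≤ t) :
    expMeasure r (Set.Iic t) ≤ ENNReal.ofReal (r * t) := by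
  have := isProbabilityMeasure_expMeasure hr
  rw [← ofReal_measureReal, ← cdf_eq_real, cdf_expMeasure_eq hr, if_pos ht]
  refine ENNReal.ofReal_le_ofReal ?_
  have := Real.add_one_le_exp (-(r * t))
  linarith

/-! ### Families of independent exponential clocks. -/

section Pi

variable {ι : Type*}

/-- The joint law of independent exponential variables with rates `r`. -/
noncomputable def expLaw [Fintype ι] (r : ι → ℝ) : Measure (ι → ℝ) :=
  Measure.pi fun i => expMeasure (r i)

theorem isProbabilityMeasure_expLaw [Fintype ι] {r : ι → ℝ} (hr : ∀ i, 0 < r i) :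
    IsProbabilityMeasure (expLaw r) := by
  have := fun i => isProbabilityMeasure_expMeasure (hr i)
  unfold expLaw
  infer_instance

theorem expLaw_ae_nonneg [Fintype ι] {r : ι → ℝ} (hr : ∀ i, 0 < r i) :
    ∀ᵐ T ∂expLaw r, ∀ i, 0 ≤ T i := by
  have := fun i => isProbabilityMeasure_expMeasure (hr i)
  rw [ae_all_iff]
  intro i
  exact (Measure.quasiMeasurePreserving_eval (μ := fun i => expMeasure (r i)) i).ae
    (expMeasure_ae_nonneg (r i))

/-- Lower the coordinates in `J` by `s`. -/
def shift [DecidableEq ι] (J : Finset ι) (s : ℝ) (T : ι → ℝ) : ι → ℝ :=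
  fun i => if i ∈ J then T i - s else T i

theorem measurable_shift [DecidableEq ι] (J : Finset ι) (s : ℝ) : Measurable (shift J s) := by
  refine measurable_pi_lambda _ fun i => ?_
  unfold shift
  by_cases h : i ∈ J <;> simp only [h, if_true, if_false] <;> fun_prop

theorem measurable_shift_uncurry [DecidableEq ι] (J : Finset ι) :
    Measurable fun q : ℝ × (ι → ℝ) => shift J q.1 q.2 := by
  refine measurable_pi_lambda _ fun i => ?_
  unfold shift
  by_cases h : i ∈ J <;> simp only [h, if_true, if_false] <;> fun_prop

theorem measurableSet_forall_le (J : Finset ι) (s : ℝ) :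
    MeasurableSet {T : ι → ℝ | ∀ i ∈ J, s ≤ T i} := by
  have : {T : ι → ℝ | ∀ i ∈ J, s ≤ T i} = ⋂ i ∈ J, {T | s ≤ T i} := by ext; simp
  rw [this]
  exact Finset.measurableSet_biInter _ fun i _ =>
    measurableSet_le measurable_const (measurable_pi_apply i)

/-- Memorylessness of a family of independent exponential variables. -/
theorem setLIntegral_shift [Fintype ι] [DecidableEq ι]
    {r : ι → ℝ} (hr : ∀ i, 0 < r i) (J : Finset ι) {s : ℝ} (hs : 0 ≤ s)
    {Ψ : (ι → ℝ) → ℝ≥0∞} (hΨ : Measurable Ψ) :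
    ∫⁻ T in {T | ∀ i ∈ J, s ≤ T i}, Ψ (shift J s T) ∂expLaw r =
      ENNReal.ofReal (Real.exp (-(s * ∑ i ∈ J, r i))) * ∫⁻ T, Ψ T ∂expLaw r := by
  have hp := fun i => isProbabilityMeasure_expMeasure (hr i)
  have hset : {T : ι → ℝ | ∀ i ∈ J, s ≤ T i} =
      Set.pi Set.univ fun i => if i ∈ J then Set.Ici s else Set.univ := by
    ext T
    simp only [Set.mem_ofPred_eq, Set.mem_pi, Set.mem_univ, true_imp_iff]
    refine forall_congr' fun i => ?_
    by_cases h : i ∈ J <;> simp [h]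
  let f : ι → ℝ → ℝ := fun i x => if i ∈ J then x - s else x
  have hf : ∀ i, Measurable (f i) := fun i => by
    by_cases h : i ∈ J <;> simp only [f, h, if_true, if_false] <;> fun_prop
  have hmap : ((expLaw r).restrict {T | ∀ i ∈ J, s ≤ T i}).map (shift J s) =
      ENNReal.ofReal (Real.exp (-(s * ∑ i ∈ J, r i))) • expLaw r := by
    unfold expLaw
    rw [hset, Measure.restrict_pi_pi]
    have h1 := Measure.pi_map_pi (μ := fun i => (expMeasure (r i)).restrict
      (if i ∈ J then Set.Ici s else Set.univ)) (f := f)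
      (hμ := fun i => by
        have : IsFiniteMeasure (((expMeasure (r i)).restrict
          (if i ∈ J then Set.Ici s else Set.univ)).map (f i)) := inferInstance
        infer_instance) (fun i => (hf i).aemeasurable)
    refine h1.trans ?_
    have h2 : ∀ i, ((expMeasure (r i)).restrict
        (if i ∈ J then Set.Ici s else Set.univ)).map (f i) =
        ENNReal.ofReal (if i ∈ J then Real.exp (-(s * r i)) else 1) • expMeasure (r i) := by
      intro i
      by_cases h : i ∈ J
      · simpa only [f, h, if_true] using expMeasure_restrict_Ici_map_sub (r i) hs
      · simp [f, h]
    simp_rw [h2]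
    have : ∀ i, IsFiniteMeasure (ENNReal.ofReal (if i ∈ J then Real.exp (-(s * r i)) else 1) •
      expMeasure (r i)) := fun i => Measure.smul_finite _ ENNReal.ofReal_ne_top
    refine Measure.pi_eq fun S _ => ?_
    simp only [Measure.smul_apply, smul_eq_mul, Measure.pi_pi, Finset.prod_mul_distrib]
    congr 1
    rw [← ENNReal.ofReal_prod_of_nonneg (fun i _ => by split_ifs <;> positivity)]
    congr 1
    rw [Finset.prod_ite_mem, Finset.univ_inter, ← Real.exp_sum, Finset.mul_sum,
      Finset.sum_neg_distrib]
  rw [← lintegral_map hΨ (measurable_shift J s), hmap, lintegral_smul_measure, smul_eq_mul]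

/-- One coordinate may be resampled independently of the others. -/
theorem lintegral_expLaw_resample [Fintype ι] [DecidableEq ι]
    {r : ι → ℝ} (hr : ∀ i, 0 < r i) (e : ι)
    {G : ℝ → (ι → ℝ) → ℝ≥0∞} (hG : Measurable (Function.uncurry G))
    (hGe : ∀ s T x, G s (Function.update T e x) = G s T) :
    ∫⁻ T, G (T e) T ∂expLaw r = ∫⁻ s, ∫⁻ T, G s T ∂expLaw r ∂expMeasure (r e) := by
  have hp := fun i => isProbabilityMeasure_expMeasure (hr i)
  have hq := isProbabilityMeasure_expLaw hr
  have hu : Measurable fun q : ℝ × (ι → ℝ) => Function.update q.2 e q.1 := by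
    refine measurable_pi_lambda _ fun i => ?_
    by_cases h : i = e
    · subst h; simpa using measurable_fst
    · simp only [Function.update_of_ne h]; fun_prop
  -- Overwriting one coordinate by an independent draw from its own law preserves the product law.
  have hmap : ((expMeasure (r e)).prod (expLaw r)).map
      (fun q : ℝ × (ι → ℝ) => Function.update q.2 e q.1) = expLaw r := by
    symm
    refine Measure.pi_eq fun S hS => ?_
    rw [Measure.map_apply hu (MeasurableSet.univ_pi hS)]
    have : (fun q : ℝ × (ι → ℝ) => Function.update q.2 e q.1) ⁻¹' Set.pi Set.univ S =
        S e ×ˢ Set.pi Set.univ (Function.update S e Set.univ) := by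
      ext ⟨s, T⟩
      simp only [Set.mem_preimage, Set.mem_pi, Set.mem_univ, true_imp_iff, Set.mem_prod]
      constructor
      · intro h
        refine ⟨by simpa using h e, fun i => ?_⟩
        by_cases hi : i = e
        · subst hi; simp
        · simpa [Function.update_of_ne hi] using h i
      · rintro ⟨h1, h2⟩ i
        by_cases hi : i = e
        · subst hi; simpa using h1
        · simpa [Function.update_of_ne hi] using h2 i
    rw [this, Measure.prod_prod]
    unfold expLaw
    rw [Measure.pi_pi, ← Finset.mul_prod_erase _ _ (Finset.mem_univ e),
      ← Finset.mul_prod_erase _ (fun i => (expMeasure (r i)) (S i)) (Finset.mem_univ e)]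
    simp only [Function.update_self, measure_univ, one_mul]
    congr 1
    refine Finset.prod_congr rfl fun i hi => ?_
    rw [Function.update_of_ne (Finset.ne_of_mem_erase hi)]
  have hG' : Measurable fun T : ι → ℝ => G (T e) T :=
    hG.comp (g := Function.uncurry G) (f := fun T : ι → ℝ => (T e, T))
      ((measurable_pi_apply e).prodMk measurable_id)
  conv_lhs => rw [← hmap]
  rw [lintegral_map hG' hu]
  simp only [Function.update_self, hGe]
  exact lintegral_prod (fun q : ℝ × (ι → ℝ) => G q.1 q.2) hG.aemeasurable

/-- The first of the clocks in `I` rings after an exponential time of rate `∑ i ∈ I, r i`, and the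
other clocks then start afresh. -/
theorem lintegral_le_of_first_clock [Fintype ι] [DecidableEq ι]
    {r : ι → ℝ} (hr : ∀ i, 0 < r i) {I : Finset ι}
    (hI : I.Nonempty) {θ : ℝ} (hθ : θ < ∑ i ∈ I, r i) {Φ : (ι → ℝ) → ℝ≥0∞}
    {Ψ : ι → (ι → ℝ) → ℝ≥0∞} (hΨ : ∀ e ∈ I, Measurable (Ψ e))
    (hΨe : ∀ e ∈ I, ∀ T x, Ψ e (Function.update T e x) = Ψ e T)
    (hΦ : ∀ T : ι → ℝ, (∀ i, 0 ≤ T i) → ∀ e ∈ I, (∀ i ∈ I, T e ≤ T i) →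
      Φ T ≤ ENNReal.ofReal (Real.exp (θ * T e)) * Ψ e (shift (I.erase e) (T e) T))
    {K : ℝ≥0∞} (hK : ∀ e ∈ I, ∫⁻ T, Ψ e T ∂expLaw r ≤ K) :
    ∫⁻ T, Φ T ∂expLaw r ≤
      ENNReal.ofReal ((∑ i ∈ I, r i) / ((∑ i ∈ I, r i) - θ)) * K := by
  classical
  set Λ := ∑ i ∈ I, r i with hΛ
  have hd : 0 < Λ - θ := sub_pos.mpr hθ
  -- The contribution of the event that clock e rings first, at time s. It does not read the
  -- coordinate e of T, so that coordinate can be integrated separately.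
  let G : ι → ℝ → (ι → ℝ) → ℝ≥0∞ := fun e s T =>
    if 0 ≤ s ∧ ∀ i ∈ I.erase e, s ≤ T i then
      ENNReal.ofReal (Real.exp (θ * s)) * Ψ e (shift (I.erase e) s T) else 0
  have hGm : ∀ e ∈ I, Measurable (Function.uncurry (G e)) := by
    intro e he
    have hset : MeasurableSet {q : ℝ × (ι → ℝ) | 0 ≤ q.1 ∧ ∀ i ∈ I.erase e, q.1 ≤ q.2 i} := by
      have : {q : ℝ × (ι → ℝ) | 0 ≤ q.1 ∧ ∀ i ∈ I.erase e, q.1 ≤ q.2 i} =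
          {q | 0 ≤ q.1} ∩ ⋂ i ∈ I.erase e, {q | q.1 ≤ q.2 i} := by ext; simp
      rw [this]
      exact (measurableSet_le measurable_const measurable_fst).inter
        (Finset.measurableSet_biInter _ fun i _ =>
          measurableSet_le measurable_fst ((measurable_pi_apply i).comp measurable_snd))
    refine Measurable.ite hset (Measurable.mul (by fun_prop) ?_) measurable_const
    exact (hΨ e he).comp (measurable_shift_uncurry _)
  have hGe : ∀ e ∈ I, ∀ s T x, G e s (Function.update T e x) = G e s T := by
    intro e he s T x
    have h1 : shift (I.erase e) s (Function.update T e x) =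
        Function.update (shift (I.erase e) s T) e x := by
      ext i
      by_cases hi : i = e
      · subst hi; simp [shift]
      · simp [shift, Function.update_of_ne hi]
    have h2 : (∀ i ∈ I.erase e, s ≤ Function.update T e x i) ↔ ∀ i ∈ I.erase e, s ≤ T i :=
      forall₂_congr fun i hi => by rw [Function.update_of_ne (Finset.ne_of_mem_erase hi)]
    simp only [G, h1, h2, hΨe e he]
  calc ∫⁻ T, Φ T ∂expLaw r ≤ ∫⁻ T, ∑ e ∈ I, G e (T e) T ∂expLaw r := by
        refine lintegral_mono_ae ?_
        filter_upwards [expLaw_ae_nonneg hr] with T hT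
        obtain ⟨e, he, hmin⟩ := I.exists_min_image T hI
        refine (hΦ T hT e he hmin).trans ?_
        -- Ties between clocks are harmless: any one minimiser supplies a term of the sum.
        refine le_trans (le_of_eq ?_)
          (Finset.single_le_sum (f := fun e => G e (T e) T) (fun _ _ => zero_le) he)
        have : 0 ≤ T e ∧ ∀ i ∈ I.erase e, T e ≤ T i :=
          ⟨hT e, fun i hi => hmin i (Finset.mem_of_mem_erase hi)⟩
        simp only [G, if_pos this]
    _ = ∑ e ∈ I, ∫⁻ T, G e (T e) T ∂expLaw r :=
        lintegral_finsetSum _ fun e he =>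
          (hGm e he).comp (g := Function.uncurry (G e)) (f := fun T : ι → ℝ => (T e, T))
            ((measurable_pi_apply e).prodMk measurable_id)
    _ ≤ ∑ e ∈ I, ENNReal.ofReal (r e / (Λ - θ)) * K := by
        refine Finset.sum_le_sum fun e he => ?_
        rw [lintegral_expLaw_resample hr e (hGm e he) (hGe e he)]
        have hsum : Λ = r e + ∑ i ∈ I.erase e, r i := (Finset.add_sum_erase I r he).symm
        calc ∫⁻ s, ∫⁻ T, G e s T ∂expLaw r ∂expMeasure (r e)
            ≤ ∫⁻ s, ENNReal.ofReal (Real.exp ((θ - ∑ i ∈ I.erase e, r i) * s)) * K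
                ∂expMeasure (r e) := by
              refine lintegral_mono_ae ?_
              filter_upwards [expMeasure_ae_nonneg (r e)] with s hs
              -- The other clocks of I survive to time s with probability exp(-s ∑ r i) and are then
              -- fresh. Together with exp(θ s) this makes the integral over s equal to r e / (Λ -
              -- θ).
              have h1 : ∫⁻ T, G e s T ∂expLaw r =
                  ∫⁻ T in {T | ∀ i ∈ I.erase e, s ≤ T i}, ENNReal.ofReal (Real.exp (θ * s)) *
                    Ψ e (shift (I.erase e) s T) ∂expLaw r := by
                rw [← lintegral_indicator (measurableSet_forall_le _ _)]
                refine lintegral_congr fun T => ?_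
                simp only [G, hs, true_and, Set.indicator_apply, Set.mem_ofPred_eq]
              rw [h1, lintegral_const_mul' _ _ ENNReal.ofReal_ne_top,
                setLIntegral_shift hr _ hs (hΨ e he), ← mul_assoc,
                ← ENNReal.ofReal_mul (Real.exp_nonneg _), ← Real.exp_add]
              refine mul_le_mul' (le_of_eq ?_) (hK e he)
              congr 2
              ring
          _ = ENNReal.ofReal (r e / (Λ - θ)) * K := by
              rw [lintegral_mul_const _ (by fun_prop),
                lintegral_exp_mul_expMeasure (hr e) (by linarith)]
              congr 3
              rw [hsum]; ring
    _ = ENNReal.ofReal (Λ / (Λ - θ)) * K := by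
        rw [← Finset.sum_mul, ← ENNReal.ofReal_sum_of_nonneg
          (fun e _ => div_nonneg (hr e).le hd.le), ← Finset.sum_div]

end Pi

/-! ### Deterministic first-passage times on a complete graph. -/

section Deterministic

variable {V : Type*} [Fintype V] [DecidableEq V]

/-- First-passage time between two vertices of the complete graph with edge weights `W`. -/
noncomputable def fpp (W : Sym2 V → ℝ) (u v : V) : ℝ :=
  ⨅ π : (⊤ : SimpleGraph V).Path u v, (π.1.edges.map W).sum

instance nonempty_path (u v : V) : Nonempty ((⊤ : SimpleGraph V).Path u v) := by
  by_cases h : u = v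
  · subst h; exact ⟨SimpleGraph.Path.nil⟩
  · exact ⟨SimpleGraph.Path.singleton (G := ⊤) h⟩

theorem exists_path_eq_fpp (W : Sym2 V → ℝ) (u v : V) :
    ∃ π : (⊤ : SimpleGraph V).Path u v, (π.1.edges.map W).sum = fpp W u v :=
  exists_eq_ciInf_of_finite

/-- Paths never use the diagonal of `Sym2 V`, so weights may be put there freely. -/
theorem fpp_congr {W W' : Sym2 V → ℝ} (h : ∀ e ∈ (⊤ : SimpleGraph V).edgeSet, W e = W' e)
    (u v : V) : fpp W u v = fpp W' u v := by
  unfold fpp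
  congr 1
  ext π
  congr 1
  exact List.map_congr_left fun e he => h e (π.1.edges_subset_edgeSet he)

theorem measurable_fpp (u v : V) : Measurable fun W : Sym2 V → ℝ => fpp W u v := by
  unfold fpp
  refine Measurable.iInf fun π => ?_
  induction π.1.edges with
  | nil => simp
  | cons e l ih =>
    simp only [List.map_cons, List.sum_cons]
    exact (measurable_pi_apply e).add ih

theorem fpp_nonneg {W : Sym2 V → ℝ} (hW : ∀ e, 0 ≤ W e) (u v : V) : 0 ≤ fpp W u v :=
  le_ciInf fun π => List.sum_nonneg fun x hx => by
    obtain ⟨e, _, rfl⟩ := List.mem_map.mp hx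
    exact hW e

theorem fpp_le_walk {W : Sym2 V → ℝ} (hW : ∀ e, 0 ≤ W e) {u v : V}
    (w : (⊤ : SimpleGraph V).Walk u v) : fpp W u v ≤ (w.edges.map W).sum := by
  refine (ciInf_le (Set.finite_range _).bddBelow ⟨w.bypass, w.bypass_isPath⟩).trans ?_
  refine List.Sublist.sum_le_sum (w.edges_bypass_sublist_edges.map W) fun x hx => ?_
  obtain ⟨e, _, rfl⟩ := List.mem_map.mp hx
  exact hW e

theorem fpp_self {W : Sym2 V → ℝ} (hW : ∀ e, 0 ≤ W e) (u : V) : fpp W u u = 0 :=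
  le_antisymm (by simpa using fpp_le_walk hW (SimpleGraph.Walk.nil (u := u)))
    (fpp_nonneg hW u u)

theorem fpp_le_add_edge {W : Sym2 V → ℝ} (hW : ∀ e, 0 ≤ W e) (u z z' : V) :
    fpp W u z' ≤ fpp W u z + W s(z, z') := by
  by_cases h : z = z'
  · subst h; linarith [hW s(z, z)]
  · obtain ⟨π, hπ⟩ := exists_path_eq_fpp W u z
    have := fpp_le_walk hW (π.1.concat (show (⊤ : SimpleGraph V).Adj z z' from h))
    rw [SimpleGraph.Walk.edges_concat] at this
    simpa [hπ] using this

/-- Potentials that grow by at most the edge weights bound first-passage times from below. -/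
theorem sub_le_fpp {W : Sym2 V → ℝ} {ψ : V → ℝ}
    (hψ : ∀ z z', z ≠ z' → ψ z' ≤ ψ z + W s(z, z')) (u v : V) : ψ v - ψ u ≤ fpp W u v := by
  have key : ∀ {u v : V} (w : (⊤ : SimpleGraph V).Walk u v), ψ v - ψ u ≤ (w.edges.map W).sum := by
    intro u v w
    induction w with
    | nil => simp
    | cons h p ih =>
      simp only [SimpleGraph.Walk.edges_cons, List.map_cons, List.sum_cons]
      linarith [hψ _ _ h.ne]
  exact le_ciInf fun π => key π.1

theorem fpp_comm (W : Sym2 V → ℝ) (u v : V) : fpp W u v = fpp W v u := by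
  have key : ∀ u v : V, fpp W u v ≤ fpp W v u := fun u v => le_ciInf fun π => by
    refine (ciInf_le (Set.finite_range _).bddBelow π.reverse).trans (le_of_eq ?_)
    simp [SimpleGraph.Path.reverse, List.sum_reverse]
  exact le_antisymm (key u v) (key v u)

/-- Set to zero the weights of the edges inside `A`. -/
def contract (A : Finset V) (W : Sym2 V → ℝ) : Sym2 V → ℝ :=
  fun e => if e ∈ A.sym2 then 0 else W e

theorem contract_nonneg {W : Sym2 V → ℝ} (hW : ∀ e, 0 ≤ W e) (A : Finset V) (e : Sym2 V) :
    0 ≤ contract A W e := by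
  unfold contract
  split_ifs
  exacts [le_rfl, hW e]

theorem contract_le {W : Sym2 V → ℝ} (hW : ∀ e, 0 ≤ W e) (A : Finset V) (e : Sym2 V) :
    contract A W e ≤ W e := by
  unfold contract
  split_ifs
  exacts [hW e, le_rfl]

theorem contract_comm (A B : Finset V) (W : Sym2 V → ℝ) :
    contract A (contract B W) = contract B (contract A W) := by
  ext e
  unfold contract
  split_ifs <;> rfl

theorem measurable_contract (A : Finset V) : Measurable (contract A) := by
  refine measurable_pi_lambda _ fun e => ?_
  unfold contract
  by_cases h : e ∈ A.sym2 <;> simp only [h, if_true, if_false] <;> fun_prop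

/-- Once its endpoint is absorbed, the edge that rang first is internal. This gives the independence
hypothesis `hΨe` of `lintegral_le_of_first_clock`. -/
theorem contract_update {A : Finset V} {e : Sym2 V} (he : e ∈ A.sym2) (W : Sym2 V → ℝ) (x : ℝ) :
    contract A (Function.update W e x) = contract A W := by
  ext f
  unfold contract
  by_cases hf : f = e
  · subst hf; simp [he]
  · rw [Function.update_of_ne hf]

theorem contract_singleton {W : Sym2 V → ℝ} (z : V) :
    ∀ e ∈ (⊤ : SimpleGraph V).edgeSet, contract {z} W e = W e := by
  intro e he
  induction e with
  | _ x y =>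
    have hxy : x ≠ y := he
    unfold contract
    rw [if_neg]
    simp only [Finset.mk_mem_sym2_iff, Finset.mem_singleton, not_and]
    exact fun hx hy => hxy (hx.trans hy.symm)

/-- The edges between `A` and `B`. -/
def between (A B : Finset V) : Finset (Sym2 V) := (A ×ˢ B).image fun q => s(q.1, q.2)

theorem mem_between {A B : Finset V} {e : Sym2 V} :
    e ∈ between A B ↔ ∃ x ∈ A, ∃ y ∈ B, e = s(x, y) := by
  simp only [between, Finset.mem_image, Finset.mem_product, Prod.exists]
  exact ⟨fun ⟨x, y, h, h'⟩ => ⟨x, h.1, y, h.2, h'.symm⟩,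
    fun ⟨x, hx, y, hy, h⟩ => ⟨x, y, ⟨hx, hy⟩, h.symm⟩⟩

theorem sum_between {A B : Finset V} (hAB : Disjoint A B) (r : Sym2 V → ℝ) :
    ∑ e ∈ between A B, r e = ∑ x ∈ A, ∑ y ∈ B, r s(x, y) := by
  rw [between, Finset.sum_image, Finset.sum_product]
  rintro ⟨a, b⟩ hab ⟨a', b'⟩ hab' h
  simp only [Finset.coe_product, Set.mem_prod, Finset.mem_coe] at hab hab'
  rcases Sym2.eq_iff.mp h with ⟨h1, h2⟩ | ⟨h1, h2⟩
  · exact Prod.ext h1 h2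
  · exact absurd ((show a = b' from h1) ▸ hab'.2) (Finset.disjoint_left.mp hAB hab.1)

/-- The edges between `A` and its complement. -/
def boundary (A : Finset V) : Finset (Sym2 V) := between A Aᶜ

theorem mem_boundary {A : Finset V} {e : Sym2 V} :
    e ∈ boundary A ↔ ∃ x ∈ A, ∃ y ∉ A, e = s(x, y) := by
  simp only [boundary, mem_between, Finset.mem_compl]

theorem mk_mem_boundary {A : Finset V} {x y : V} :
    s(x, y) ∈ boundary A ↔ (x ∈ A ∧ y ∉ A) ∨ (y ∈ A ∧ x ∉ A) := by
  rw [mem_boundary]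
  constructor
  · rintro ⟨a, ha, b, hb, h⟩
    rcases Sym2.eq_iff.mp h with ⟨rfl, rfl⟩ | ⟨rfl, rfl⟩
    exacts [Or.inl ⟨ha, hb⟩, Or.inr ⟨ha, hb⟩]
  · rintro (⟨h1, h2⟩ | ⟨h1, h2⟩)
    exacts [⟨x, h1, y, h2, rfl⟩, ⟨y, h1, x, h2, Sym2.eq_swap⟩]

theorem sum_boundary (A : Finset V) (r : Sym2 V → ℝ) :
    ∑ e ∈ boundary A, r e = ∑ x ∈ A, ∑ y ∈ Aᶜ, r s(x, y) :=
  sum_between disjoint_compl_right r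

theorem shift_nonneg {ι : Type*} [DecidableEq ι] {J : Finset ι} {s : ℝ} {T : ι → ℝ}
    (hT : ∀ i, 0 ≤ T i) (hJ : ∀ i ∈ J, s ≤ T i) (i : ι) : 0 ≤ shift J s T i := by
  unfold shift
  split_ifs with h
  exacts [sub_nonneg.mpr (hJ i h), hT i]

/-- With the edges inside A made free, the distance from a point u of A is the distance from the
whole set A. This is how a cluster is encoded below. -/
theorem fpp_eq_zero_of_mem {W : Sym2 V → ℝ} (hW : ∀ e, 0 ≤ W e) {A : Finset V} {u z : V}
    (hu : u ∈ A) (hz : z ∈ A) (h0 : ∀ e ∈ A.sym2, W e = 0) : fpp W u z = 0 := by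
  refine le_antisymm ?_ (fpp_nonneg hW u z)
  have := fpp_le_add_edge hW u u z
  rwa [fpp_self hW, h0 _ (Finset.mk_mem_sym2_iff.mpr ⟨hu, hz⟩), add_zero] at this

/-- Absorbing into `A` the vertex at the end of the lightest edge leaving `A`, whose weight is then
subtracted from the other edges leaving `A`, shortens distances from `A` by at most that weight. -/
theorem fpp_contract_le_absorb {T : Sym2 V → ℝ} (hT : ∀ e, 0 ≤ T e) {A : Finset V} (B : Finset V)
    {u : V} (hu : u ∈ A) (v : V) {x y : V} (hx : x ∈ A) (hy : y ∉ A)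
    (hmin : ∀ f ∈ boundary A, T s(x, y) ≤ T f) :
    fpp (contract B (contract A T)) u v ≤ T s(x, y) +
      fpp (contract B (contract (insert y A)
        (shift ((boundary A).erase s(x, y)) (T s(x, y)) T))) u v := by
  set c := T s(x, y) with hc
  set T' := shift ((boundary A).erase s(x, y)) c T with hT'
  have hT'0 : ∀ e, 0 ≤ T' e :=
    shift_nonneg hT fun f hf => hmin f (Finset.mem_of_mem_erase hf)
  set W := contract B (contract A T) with hW
  set W' := contract B (contract (insert y A) T') with hW'
  have hW0 : ∀ e, 0 ≤ W e := contract_nonneg (contract_nonneg hT A) B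
  have hW'0 : ∀ e, 0 ≤ W' e := contract_nonneg (contract_nonneg hT'0 _) B
  have hWT : ∀ e, W e ≤ T e := fun e =>
    (contract_le (contract_nonneg hT A) B e).trans (contract_le hT A e)
  have hzero : ∀ z ∈ A, fpp W u z = 0 := fun z hz =>
    fpp_eq_zero_of_mem hW0 hu hz fun e he => by simp [hW, contract, he]
  have hyc : fpp W u y ≤ c := by
    have := fpp_le_add_edge hW0 u x y
    rw [hzero x hx] at this
    linarith [hWT s(x, y)]
  have hc0 : 0 ≤ c := hT _
  -- The potential is the old distance reduced by c and truncated at 0, so it vanishes on the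
  -- enlarged cluster. Only edges leaving A lost weight, and a step along one starts at old distance
  -- 0, which pays for the loss.
  have key := sub_le_fpp (W := W') (ψ := fun z => max (fpp W u z - c) 0) (fun z z' hne => by
    have hψ : 0 ≤ max (fpp W u z - c) 0 := le_max_right _ _
    have hψ' : fpp W u z - c ≤ max (fpp W u z - c) 0 := le_max_left _ _
    have h0 := hW'0 s(z, z')
    refine max_le ?_ (by linarith)
    by_cases hz' : z' ∈ insert y A
    · have : fpp W u z' ≤ c := by
        rcases Finset.mem_insert.mp hz' with rfl | h
        exacts [hyc, (hzero _ h).le.trans hc0]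
      linarith
    · have hstep := fpp_le_add_edge hW0 u z z'
      by_cases hB : s(z, z') ∈ B.sym2
      · have : W s(z, z') = 0 := by simp only [hW, contract, hB, if_true]
        linarith
      · have h1 : s(z, z') ∉ (insert y A).sym2 := fun h =>
          hz' (Finset.mk_mem_sym2_iff.mp h).2
        have h2 : W' s(z, z') = T' s(z, z') := by
          simp only [hW', contract, hB, h1, if_false]
        rw [Finset.mem_insert, not_or] at hz'
        by_cases hz : z ∈ A
        · have h3 : s(z, z') ∈ (boundary A).erase s(x, y) := by
            refine Finset.mem_erase.mpr ⟨fun h => ?_, mk_mem_boundary.mpr (Or.inl ⟨hz, hz'.2⟩)⟩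
            rcases Sym2.eq_iff.mp h with ⟨_, h⟩ | ⟨_, h⟩
            exacts [hz'.1 h, hz'.2 (h ▸ hx)]
          have h4 : T' s(z, z') = T s(z, z') - c := if_pos h3
          linarith [hzero z hz, hWT s(z, z')]
        · have h3 : s(z, z') ∉ (boundary A).erase s(x, y) := fun h => by
            rcases mk_mem_boundary.mp (Finset.mem_of_mem_erase h) with h | h
            exacts [hz h.1, hz'.2 h.1]
          have h4 : T' s(z, z') = T s(z, z') := if_neg h3
          linarith [hWT s(z, z')]) u v
  have hself : max (fpp W u u - c) 0 = 0 := by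
    rw [fpp_self hW0]; exact max_eq_right (by linarith)
  simp only [hself, sub_zero] at key
  linarith [le_max_left (fpp W u v - c) 0]

/-- The converse of `fpp_contract_le_absorb`. -/
theorem absorb_le_fpp_contract {T : Sym2 V → ℝ} (hT : ∀ e, 0 ≤ T e) {A : Finset V}
    {u v : V} (hu : u ∈ A) (hv : v ∉ A) {x y : V} (hx : x ∈ A)
    (hmin : ∀ f ∈ boundary A, T s(x, y) ≤ T f) :
    T s(x, y) + fpp (contract (insert y A)
        (shift ((boundary A).erase s(x, y)) (T s(x, y)) T)) u v ≤ fpp (contract A T) u v := by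
  set c := T s(x, y) with hc
  set T' := shift ((boundary A).erase s(x, y)) c T with hT'
  have hT'0 : ∀ e, 0 ≤ T' e :=
    shift_nonneg hT fun f hf => hmin f (Finset.mem_of_mem_erase hf)
  set W := contract A T with hW
  set W' := contract (insert y A) T' with hW'
  have hW0 : ∀ e, 0 ≤ W e := contract_nonneg hT A
  have hW'0 : ∀ e, 0 ≤ W' e := contract_nonneg hT'0 _
  have hzero : ∀ z ∈ insert y A, fpp W' u z = 0 := fun z hz =>
    fpp_eq_zero_of_mem hW'0 (Finset.mem_insert_of_mem hu) hz fun e he => by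
      simp [hW', contract, he]
  have hc0 : 0 ≤ c := hT _
  -- The potential jumps by c on leaving A. Every edge leaving A affords this: all but the lightest
  -- had c subtracted, and the lightest weighs c and ends at y, where the new distance is 0.
  have key := sub_le_fpp (W := W) (ψ := fun z => if z ∈ A then 0 else c + fpp W' u z)
    (fun z z' hne => by
      have h0 := hW0 s(z, z')
      have hf0 := fpp_nonneg hW'0 u z
      have hstep := fpp_le_add_edge hW'0 u z z'
      by_cases hz' : z' ∈ A
      · simp only [hz', if_true]
        split_ifs <;> linarith
      · have h1 : s(z, z') ∉ A.sym2 := fun h => hz' (Finset.mk_mem_sym2_iff.mp h).2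
        have h2 : W s(z, z') = T s(z, z') := if_neg h1
        by_cases hz : z ∈ A
        · simp only [hz, hz', if_true, if_false]
          have hb : s(z, z') ∈ boundary A := mk_mem_boundary.mpr (Or.inl ⟨hz, hz'⟩)
          by_cases hz'y : z' = y
          · rw [hzero z' (hz'y ▸ Finset.mem_insert_self _ _), h2]
            linarith [hmin _ hb]
          · have h3 : s(z, z') ∈ (boundary A).erase s(x, y) := by
              refine Finset.mem_erase.mpr ⟨fun h => ?_, hb⟩
              rcases Sym2.eq_iff.mp h with ⟨_, h⟩ | ⟨_, h⟩
              exacts [hz'y h, hz' (h ▸ hx)]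
            have h4 : T' s(z, z') = T s(z, z') - c := if_pos h3
            linarith [hzero z (Finset.mem_insert_of_mem hz), contract_le hT'0 (insert y A) s(z, z')]
        · simp only [hz, hz', if_false]
          have h3 : s(z, z') ∉ (boundary A).erase s(x, y) := fun h => by
            rcases mk_mem_boundary.mp (Finset.mem_of_mem_erase h) with h | h
            exacts [hz h.1, hz' h.1]
          have h4 : T' s(z, z') = T s(z, z') := if_neg h3
          linarith [contract_le hT'0 (insert y A) s(z, z')]) u v
  simpa [hu, hv] using key

/-- The joining step: movement inside each cluster is free, so one edge across suffices. -/
theorem fpp_contract_le_edge {T : Sym2 V → ℝ} (hT : ∀ e, 0 ≤ T e) {A B : Finset V} {u v x y : V}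
    (hu : u ∈ A) (hv : v ∈ B) (hx : x ∈ A) (hy : y ∈ B) :
    fpp (contract B (contract A T)) u v ≤ T s(x, y) := by
  have hW0 := contract_nonneg (contract_nonneg hT A) B
  have h1 : fpp (contract B (contract A T)) u x = 0 :=
    fpp_eq_zero_of_mem hW0 hu hx fun e he => by simp [contract, he]
  have h2 := fpp_le_add_edge hW0 u x y
  have h3 := fpp_le_add_edge hW0 u y v
  have h4 : contract B (contract A T) s(y, v) = 0 := if_pos (Finset.mk_mem_sym2_iff.mpr ⟨hy, hv⟩)
  have h5 : contract B (contract A T) s(x, y) ≤ T s(x, y) :=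
    (contract_le (contract_nonneg hT A) B _).trans (contract_le hT A _)
  linarith

theorem fpp_contract_eq_zero {T : Sym2 V → ℝ} (hT : ∀ e, 0 ≤ T e) {A B : Finset V} {u v x : V}
    (hu : u ∈ A) (hv : v ∈ B) (hxA : x ∈ A) (hxB : x ∈ B) :
    fpp (contract B (contract A T)) u v = 0 := by
  have hW0 := contract_nonneg (contract_nonneg hT A) B
  refine le_antisymm ?_ (fpp_nonneg hW0 u v)
  have h1 : fpp (contract B (contract A T)) u x = 0 :=
    fpp_eq_zero_of_mem hW0 hu hxA fun e he => by simp [contract, he]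
  have h3 := fpp_le_add_edge hW0 u x v
  have h4 : contract B (contract A T) s(x, v) = 0 := if_pos (Finset.mk_mem_sym2_iff.mpr ⟨hxB, hv⟩)
  linarith

/-- If all edges at `v` have weight at least `s`, then `s` can be taken off each of them. -/
theorem shift_boundary_add_le_fpp {T : Sym2 V → ℝ} (hT : ∀ e, 0 ≤ T e) {s : ℝ} (hs : 0 ≤ s)
    {u v : V} (huv : u ≠ v) (hv : ∀ f ∈ boundary {v}, s ≤ T f) :
    s + fpp (shift (boundary {v}) s T) u v ≤ fpp T u v := by
  set T' := shift (boundary {v}) s T with hT'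
  have hT'0 : ∀ e, 0 ≤ T' e := shift_nonneg hT hv
  have key := sub_le_fpp (W := T) (ψ := fun z => (if z = v then s else 0) + fpp T' u z)
    (fun z z' hne => by
      have hstep := fpp_le_add_edge hT'0 u z z'
      by_cases hz' : z' = v
      · have hz : z ≠ v := fun h => hne (h.trans hz'.symm)
        have h3 : s(z, z') ∈ boundary {v} := mk_mem_boundary.mpr (Or.inr (by simp [hz, hz']))
        have h4 : T' s(z, z') = T s(z, z') - s := if_pos h3
        simp only [hz', hz, if_true, if_false] at *
        linarith
      · by_cases hz : z = v
        · have h3 : s(z, z') ∈ boundary {v} := mk_mem_boundary.mpr (Or.inl (by simp [hz, hz']))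
          have h4 : T' s(z, z') = T s(z, z') - s := if_pos h3
          simp only [hz', hz, if_true, if_false] at *
          linarith
        · have h3 : s(z, z') ∉ boundary {v} := fun h => by
            rcases mk_mem_boundary.mp h with h | h
            exacts [hz (by simpa using h.1), hz' (by simpa using h.1)]
          have h4 : T' s(z, z') = T s(z, z') := if_neg h3
          simp only [hz', hz, if_false] at *
          linarith) u v
  simpa [huv, fpp_self hT'0] using key

/-- Two-point version of `shift_boundary_add_le_fpp`. -/
theorem shift_boundary_union_add_le_fpp {T : Sym2 V → ℝ} (hT : ∀ e, 0 ≤ T e) {s : ℝ} (hs : 0 ≤ s)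
    {v w : V} (hvw : v ≠ w) (hJ : ∀ f ∈ boundary {v} ∪ boundary {w}, s ≤ T f) :
    min (2 * s + fpp (shift (boundary {v} ∪ boundary {w}) s T) v w)
      (s + shift (boundary {v} ∪ boundary {w}) s T s(v, w)) ≤ fpp T v w := by
  set T' := shift (boundary {v} ∪ boundary {w}) s T with hT'
  have hT'0 : ∀ e, 0 ≤ T' e := shift_nonneg hT hJ
  have hmem : ∀ z z', z ≠ z' → (s(z, z') ∈ boundary {v} ∪ boundary {w} ↔
      z = v ∨ z' = v ∨ z = w ∨ z' = w) := by
    intro z z' hne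
    simp only [Finset.mem_union, mk_mem_boundary, Finset.mem_singleton]
    grind
  -- A path from v to w either leaves v and enters w by different edges, each of which lost s, or is
  -- the single edge vw, which lost s only once. Hence the minimum, used as the value of the
  -- potential at w.
  set m := min (2 * s + fpp T' v w) (s + T' s(v, w)) with hm
  have hm1 : m ≤ 2 * s + fpp T' v w := min_le_left _ _
  have hm2 : m ≤ s + T' s(v, w) := min_le_right _ _
  have hw := fpp_le_add_edge hT'0 v v w
  rw [fpp_self hT'0] at hw
  have hm3 : s + fpp T' v w ≤ m := le_min (by linarith) (by linarith)
  have hw0 := fpp_nonneg hT'0 v w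
  have key := sub_le_fpp (W := T)
    (ψ := fun z => if z = v then 0 else if z = w then m else s + fpp T' v z)
    (fun z z' hne => by
      have hstep := fpp_le_add_edge hT'0 v z z'
      have hz0 := fpp_nonneg hT'0 v z
      have h0 := hT s(z, z')
      have hself := fpp_self hT'0 v
      by_cases hE : z = v ∨ z' = v ∨ z = w ∨ z' = w
      · have h4 : T' s(z, z') = T s(z, z') - s := if_pos ((hmem z z' hne).mpr hE)
        by_cases hz'v : z' = v
        · simp only [hz'v, if_true] at *
          split_ifs <;> linarith
        by_cases hzv : z = v
        · by_cases hz'w : z' = w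
          · subst hzv hz'w
            simp only [hz'v, if_true, if_false]
            linarith
          · subst hzv
            simp only [hz'v, hz'w, if_true, if_false]
            linarith
        by_cases hz'w : z' = w
        · have hzw : z ≠ w := fun h => hne (h.trans hz'w.symm)
          subst hz'w
          simp only [hz'v, hzv, hzw, if_true, if_false]
          linarith
        have hzw : z = w := by tauto
        subst hzw
        simp only [hz'v, hz'w, hzv, if_true, if_false]
        linarith
      · have h4 : T' s(z, z') = T s(z, z') := if_neg fun h => hE ((hmem z z' hne).mp h)
        push Not at hE
        simp only [hE.1, hE.2.1, hE.2.2.1, hE.2.2.2, if_false]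
        linarith) v w
  simpa [hvw.symm] using key

end Deterministic

/-! ### Exponential moments of the growth process. -/

section Moments

variable {V : Type*} [Fintype V] [DecidableEq V] {r : Sym2 V → ℝ}

/-- One birth: the wait for the next vertex contributes Λ/(Λ - θ), and the process restarts from the
enlarged cluster, whichever vertex arrived. The other cluster B is left untouched. -/
theorem lintegral_exp_fpp_absorb (hr : ∀ e, 0 < r e) {θ : ℝ} (hθ0 : 0 ≤ θ) {A : Finset V}
    (B : Finset V) {u : V} (hu : u ∈ A) (v : V) (hθ : θ < ∑ e ∈ boundary A, r e) {K : ℝ≥0∞}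
    (hK : ∀ y ∉ A, ∫⁻ T, ENNReal.ofReal (Real.exp
      (θ * fpp (contract B (contract (insert y A) T)) u v)) ∂expLaw r ≤ K) :
    ∫⁻ T, ENNReal.ofReal (Real.exp (θ * fpp (contract B (contract A T)) u v)) ∂expLaw r ≤
      ENNReal.ofReal ((∑ e ∈ boundary A, r e) / ((∑ e ∈ boundary A, r e) - θ)) * K := by
  have hI : (boundary A).Nonempty := by
    by_contra h
    rw [Finset.not_nonempty_iff_eq_empty] at h
    rw [h, Finset.sum_empty] at hθ
    linarith
  have : Nonempty V := ⟨u⟩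
  have hb : ∀ e, e ∈ boundary A → ∃ x y, x ∈ A ∧ y ∉ A ∧ e = s(x, y) := fun e he => by
    obtain ⟨x, hx, y, hy, h⟩ := mem_boundary.mp he
    exact ⟨x, y, hx, hy, h⟩
  choose! x y hx hy hxy using hb
  refine lintegral_le_of_first_clock hr hI hθ (Ψ := fun e T => ENNReal.ofReal (Real.exp
      (θ * fpp (contract B (contract (insert (y e) A) T)) u v))) (fun e _ => ?_)
    (fun e he T z => ?_) (fun T hT e he hmin => ?_) (fun e he => hK _ (hy e he))
  · have := (measurable_fpp u v).comp
      ((measurable_contract B).comp (measurable_contract (insert (y e) A)))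
    exact (Real.measurable_exp.comp (this.const_mul θ)).ennreal_ofReal
  · have : e ∈ (insert (y e) A).sym2 := by
      have h := Finset.mk_mem_sym2_iff.mpr ⟨Finset.mem_insert_of_mem (b := y e) (hx e he),
        Finset.mem_insert_self (y e) A⟩
      rwa [← hxy e he] at h
    simp only [contract_update this]
  · rw [← ENNReal.ofReal_mul (Real.exp_nonneg _), ← Real.exp_add, ← mul_add]
    refine ENNReal.ofReal_le_ofReal (Real.exp_le_exp.mpr (mul_le_mul_of_nonneg_left ?_ hθ0))
    have := fpp_contract_le_absorb hT B hu v (hx e he) (hy e he)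
      (fun f hf => by rw [← hxy e he]; exact hmin f hf)
    rwa [← hxy e he] at this

/-- With θ = (1 - δ)ρ and Λ ≥ ρ a at size a, one birth costs at most a/(a - 1 + δ) ≤ (a + δ)/(a - 1
+ δ), and these factors telescope up to size k. The margin δ keeps the first factor, a = 1, finite.
-/
theorem lintegral_exp_fpp_grow (hr : ∀ e, 0 < r e) {ρ δ : ℝ} (hρ : 0 < ρ) (hδ : 0 < δ)
    (hδ1 : δ ≤ 1) {k : ℕ}
    (hΛ : ∀ A : Finset V, A.Nonempty → A.card < k → ρ * A.card ≤ ∑ e ∈ boundary A, r e)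
    (B : Finset V) (u v : V) {K : ℝ≥0∞}
    (hK : ∀ A : Finset V, u ∈ A → A.card = k → ∫⁻ T, ENNReal.ofReal (Real.exp
      ((1 - δ) * ρ * fpp (contract B (contract A T)) u v)) ∂expLaw r ≤ K) (j : ℕ) :
    ∀ A : Finset V, u ∈ A → A.card + j = k →
      ∫⁻ T, ENNReal.ofReal (Real.exp
        ((1 - δ) * ρ * fpp (contract B (contract A T)) u v)) ∂expLaw r ≤
        ENNReal.ofReal ((k - 1 + δ) / (A.card - 1 + δ)) * K := by
  induction j with
  | zero =>
    intro A hu hA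
    have hA' : A.card = k := hA
    have h1 : (1 : ℝ) ≤ A.card := by exact_mod_cast Finset.card_pos.mpr ⟨u, hu⟩
    rw [← hA', div_self (by linarith), ENNReal.ofReal_one, one_mul]
    exact hK A hu hA'
  | succ j ih =>
    intro A hu hA
    have h1 : (1 : ℝ) ≤ A.card := by exact_mod_cast Finset.card_pos.mpr ⟨u, hu⟩
    have hk : (A.card : ℝ) ≤ k := by exact_mod_cast (by omega : A.card ≤ k)
    have hΛA := hΛ A ⟨u, hu⟩ (by omega)
    set Λ := ∑ e ∈ boundary A, r e
    have hθ : (1 - δ) * ρ < Λ := by nlinarith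
    have hc : ∀ y ∉ A, (insert y A).card = A.card + 1 := fun y hy =>
      Finset.card_insert_of_notMem hy
    refine (lintegral_exp_fpp_absorb hr (mul_nonneg (by linarith) hρ.le) B hu v hθ
      (K := ENNReal.ofReal ((k - 1 + δ) / (A.card + δ)) * K) (fun y hy => ?_)).trans ?_
    · have := ih (insert y A) (Finset.mem_insert_of_mem hu) (by rw [hc y hy]; omega)
      rwa [hc y hy, Nat.cast_add, Nat.cast_one, add_sub_cancel_right] at this
    · rw [← mul_assoc, ← ENNReal.ofReal_mul (div_nonneg (by nlinarith) (by linarith))]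
      refine mul_le_mul' (ENNReal.ofReal_le_ofReal ?_) le_rfl
      -- Λ/(Λ - θ) decreases in Λ, so Λ may be replaced by its lower bound ρ |A|.
      have h2 : Λ / (Λ - (1 - δ) * ρ) ≤ A.card / (A.card - 1 + δ) := by
        rw [div_le_div_iff₀ (by linarith) (by linarith)]
        nlinarith
      calc Λ / (Λ - (1 - δ) * ρ) * ((k - 1 + δ) / (A.card + δ))
          ≤ A.card / (A.card - 1 + δ) * ((k - 1 + δ) / (A.card + δ)) :=
            mul_le_mul_of_nonneg_right h2 (div_nonneg (by linarith) (by linarith))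
        _ = A.card / (A.card + δ) * ((k - 1 + δ) / (A.card - 1 + δ)) := by ring
        _ ≤ 1 * ((k - 1 + δ) / (A.card - 1 + δ)) := by
            refine mul_le_mul_of_nonneg_right ?_ (div_nonneg (by linarith) (by linarith))
            rw [div_le_one (by linarith)]
            linarith
        _ = _ := one_mul _

/-- The exponential moment of the passage time between two vertices, obtained by growing a set of
`k` vertices around each of them and then joining these sets by an edge. -/
theorem lintegral_exp_fpp_le (hr : ∀ e, 0 < r e) {ρ δ : ℝ} (hρ : 0 < ρ) (hδ : 0 < δ)
    (hδ1 : δ < 1) {k : ℕ} (hk : 1 ≤ k)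
    (hΛ : ∀ A : Finset V, A.Nonempty → A.card < k → ρ * A.card ≤ ∑ e ∈ boundary A, r e)
    (hAB : ∀ A B : Finset V, Disjoint A B → A.card = k → B.card = k →
      2 * ρ ≤ ∑ x ∈ A, ∑ y ∈ B, r s(x, y)) (u v : V) :
    ∫⁻ T, ENNReal.ofReal (Real.exp ((1 - δ) * ρ * fpp T u v)) ∂expLaw r ≤
      ENNReal.ofReal (2 * (k / δ) ^ 2) := by
  have hprob := isProbabilityMeasure_expLaw hr
  have hθ0 : 0 < (1 - δ) * ρ := mul_pos (by linarith) hρ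
  have hjoin : ∀ A B : Finset V, u ∈ A → v ∈ B → A.card = k → B.card = k →
      ∫⁻ T, ENNReal.ofReal (Real.exp ((1 - δ) * ρ * fpp (contract B (contract A T)) u v))
        ∂expLaw r ≤ 2 := by
    intro A B hu hv hA hB
    by_cases hd : Disjoint A B
    · have hI : (between A B).Nonempty := ⟨s(u, v), mem_between.mpr ⟨u, hu, v, hv, rfl⟩⟩
      have hΛ2 := hAB A B hd hA hB
      rw [← sum_between hd] at hΛ2
      have hlt : (1 - δ) * ρ < ∑ e ∈ between A B, r e := by nlinarith
      refine (lintegral_le_of_first_clock hr hI hlt (Ψ := fun _ _ => 1) (K := 1)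
        (fun _ _ => measurable_const) (fun _ _ _ _ => rfl) (fun T hT e he _ => ?_)
        (fun _ _ => by simp)).trans ?_
      · obtain ⟨x, hx, y, hy, rfl⟩ := mem_between.mp he
        rw [mul_one]
        exact ENNReal.ofReal_le_ofReal (Real.exp_le_exp.mpr
          (mul_le_mul_of_nonneg_left (fpp_contract_le_edge hT hu hv hx hy) hθ0.le))
      -- The joining rate is at least 2ρ ≥ 2θ, so the joining time has exponential moment at most 2.
      · rw [mul_one, ← ENNReal.ofReal_ofNat]
        refine ENNReal.ofReal_le_ofReal ?_
        rw [div_le_iff₀ (by linarith)]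
        nlinarith
    · obtain ⟨x, hxA, hxB⟩ := Finset.not_disjoint_iff.mp hd
      calc _ ≤ ∫⁻ _, 1 ∂expLaw r := by
            refine lintegral_mono_ae ?_
            filter_upwards [expLaw_ae_nonneg hr] with T hT
            rw [fpp_contract_eq_zero hT hu hv hxA hxB]
            simp
        _ ≤ 2 := by simp
  -- With A fixed, the cluster of v is grown from a singleton, the roles of u and v being exchanged
  -- by symmetry. The result is the terminal bound for growing the cluster of u.
  have hgrow : ∀ A : Finset V, u ∈ A → A.card = k →
      ∫⁻ T, ENNReal.ofReal (Real.exp ((1 - δ) * ρ * fpp (contract {v} (contract A T)) u v))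
        ∂expLaw r ≤ ENNReal.ofReal ((k - 1 + δ) / δ) * 2 := by
    intro A hu hA
    have := lintegral_exp_fpp_grow hr hρ hδ hδ1.le hΛ A v u (K := 2) (fun B hv hB => by
      simp_rw [fpp_comm _ v u, contract_comm A B]
      exact hjoin A B hu hv hA hB) (k - 1) {v} (Finset.mem_singleton_self v)
      (by rw [Finset.card_singleton]; omega)
    simp_rw [fpp_comm _ v u, contract_comm A {v}] at this
    simpa using this
  have := lintegral_exp_fpp_grow hr hρ hδ hδ1.le hΛ {v} u v hgrow (k - 1) {u}
    (Finset.mem_singleton_self u) (by rw [Finset.card_singleton]; omega)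
  have hcs : ∀ T : Sym2 V → ℝ, fpp (contract {v} (contract {u} T)) u v = fpp T u v := fun T =>
    fpp_congr (fun e he => (contract_singleton v e he).trans (contract_singleton u e he)) u v
  simp only [hcs, Finset.card_singleton, Nat.cast_one, sub_self, zero_add] at this
  refine this.trans ?_
  have hk1 : (1 : ℝ) ≤ k := by exact_mod_cast hk
  have h0 : 0 ≤ (k - 1 + δ) / δ := div_nonneg (by linarith) hδ.le
  rw [← ENNReal.ofReal_ofNat, ← ENNReal.ofReal_mul h0, ← ENNReal.ofReal_mul h0]
  refine ENNReal.ofReal_le_ofReal ?_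
  have h1 : (k - 1 + δ) / δ ≤ k / δ := div_le_div_of_nonneg_right (by linarith) hδ.le
  nlinarith [mul_self_le_mul_self h0 h1]

/-- The expected number of vertices reached by time `t`, in Laplace-transformed form. -/
theorem lintegral_sum_exp_neg_fpp_le (hr : ∀ e, 0 < r e) {R τ : ℝ} (hR : 0 < R) (hτ : 1 < τ)
    (hΛ : ∀ A : Finset V, ∑ e ∈ boundary A, r e ≤ A.card * R) (u : V) (j : ℕ) :
    ∀ A : Finset V, u ∈ A → Aᶜ.card = j →
      ∫⁻ T, ∑ v ∈ Aᶜ, ENNReal.ofReal (Real.exp (-(τ * R) * fpp (contract A T) u v)) ∂expLaw r ≤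
        ENNReal.ofReal (A.card / (τ - 1)) := by
  have hprob := isProbabilityMeasure_expLaw hr
  have : Nonempty V := ⟨u⟩
  have hmeas : ∀ (A : Finset V) (v : V), Measurable fun T : Sym2 V → ℝ =>
      ENNReal.ofReal (Real.exp (-(τ * R) * fpp (contract A T) u v)) := fun A v =>
    (Real.measurable_exp.comp
      (((measurable_fpp u v).comp (measurable_contract A)).const_mul _)).ennreal_ofReal
  induction j with
  | zero =>
    intro A _ hA
    rw [Finset.card_eq_zero.mp hA]
    simp
  | succ j ih =>
    intro A hu hA
    obtain ⟨z, hz⟩ : Aᶜ.Nonempty := Finset.card_pos.mp (by omega)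
    have hI : (boundary A).Nonempty :=
      ⟨s(u, z), mk_mem_boundary.mpr (Or.inl ⟨hu, Finset.mem_compl.mp hz⟩)⟩
    have h1 : (1 : ℝ) ≤ A.card := by exact_mod_cast Finset.card_pos.mpr ⟨u, hu⟩
    have hΛ0 : 0 < ∑ e ∈ boundary A, r e := Finset.sum_pos (fun e _ => hr e) hI
    have hΛA := hΛ A
    set Λ := ∑ e ∈ boundary A, r e
    have hb : ∀ e, e ∈ boundary A → ∃ x y, x ∈ A ∧ y ∉ A ∧ e = s(x, y) := fun e he => by
      obtain ⟨x, hx, y, hy, h⟩ := mem_boundary.mp he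
      exact ⟨x, y, hx, hy, h⟩
    choose! x y hx hy hxy using hb
    have hθ0 : 0 < τ * R := by positivity
    -- The exponent is now negative: time is discounted at rate τR. The newly absorbed vertex counts
    -- 1, and the vertices still outside continue from the larger cluster.
    refine (lintegral_le_of_first_clock (θ := -(τ * R)) hr hI (by linarith)
      (Ψ := fun e T => 1 + ∑ v ∈ (insert (y e) A)ᶜ,
        ENNReal.ofReal (Real.exp (-(τ * R) * fpp (contract (insert (y e) A) T) u v)))
      (K := ENNReal.ofReal (1 + (A.card + 1) / (τ - 1)))
      (fun e _ => ?_) (fun e he T z => ?_) (fun T hT e he hmin => ?_) (fun e he => ?_)).trans ?_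
    · exact measurable_const.add (Finset.measurable_fun_sum _ fun v _ => hmeas _ v)
    · have : e ∈ (insert (y e) A).sym2 := by
        have h := Finset.mk_mem_sym2_iff.mpr ⟨Finset.mem_insert_of_mem (b := y e) (hx e he),
          Finset.mem_insert_self (y e) A⟩
        rwa [← hxy e he] at h
      simp only [contract_update this]
    · have habs : ∀ v ∉ A, T e + fpp (contract (insert (y e) A)
          (shift ((boundary A).erase e) (T e) T)) u v ≤ fpp (contract A T) u v := by
        intro v hv
        have := absorb_le_fpp_contract hT hu hv (hx e he) (y := y e)
          (fun f hf => by rw [← hxy e he]; exact hmin f hf)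
        rwa [← hxy e he] at this
      have hnn : ∀ i, 0 ≤ shift ((boundary A).erase e) (T e) T i :=
        shift_nonneg hT fun f hf => hmin f (Finset.mem_of_mem_erase hf)
      have hcompl : Aᶜ = insert (y e) (insert (y e) A)ᶜ := by
        rw [Finset.compl_insert, Finset.insert_erase (Finset.mem_compl.mpr (hy e he))]
      rw [hcompl, Finset.sum_insert (by simp), mul_add, mul_one, Finset.mul_sum]
      refine add_le_add (ENNReal.ofReal_le_ofReal (Real.exp_le_exp.mpr ?_))
        (Finset.sum_le_sum fun v hv => ?_)
      · have h2 := habs (y e) (hy e he)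
        have h3 := fpp_nonneg (contract_nonneg hnn (insert (y e) A)) u (y e)
        nlinarith
      · rw [← ENNReal.ofReal_mul (Real.exp_nonneg _), ← Real.exp_add, ← mul_add]
        refine ENNReal.ofReal_le_ofReal (Real.exp_le_exp.mpr ?_)
        have hv' : v ∉ A := fun h => Finset.mem_compl.mp hv (Finset.mem_insert_of_mem h)
        have h2 := habs v hv'
        nlinarith
    · rw [lintegral_add_left measurable_const, lintegral_one, measure_univ,
        ENNReal.ofReal_add zero_le_one (div_nonneg (by positivity) (by linarith)),
        ENNReal.ofReal_one]
      refine add_le_add le_rfl ?_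
      have hc : (insert (y e) A).card = A.card + 1 := Finset.card_insert_of_notMem (hy e he)
      have := ih (insert (y e) A) (Finset.mem_insert_of_mem hu) (by
        rw [Finset.card_compl] at hA ⊢
        omega)
      rwa [hc, Nat.cast_add, Nat.cast_one] at this
    · rw [← ENNReal.ofReal_mul (div_nonneg hΛ0.le (by linarith))]
      refine ENNReal.ofReal_le_ofReal ?_
      have hτ' : 0 < τ - 1 := by linarith
      have h2 : Λ / (Λ - -(τ * R)) ≤ A.card / (A.card + τ) := by
        rw [div_le_div_iff₀ (by linarith) (by linarith)]
        nlinarith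
      have h3 : (1 + ((A.card : ℝ) + 1) / (τ - 1)) = (A.card + τ) / (τ - 1) := by
        field_simp; ring
      rw [h3]
      refine (mul_le_mul_of_nonneg_right h2 (by positivity)).trans (le_of_eq ?_)
      have : (A.card : ℝ) + τ ≠ 0 := by positivity
      field_simp

/-- Bound on the expected number of vertices within distance `t` of `u`. -/
theorem sum_measure_fpp_le (hr : ∀ e, 0 < r e) {R τ : ℝ} (hR : 0 < R) (hτ : 1 < τ)
    (hΛ : ∀ A : Finset V, ∑ e ∈ boundary A, r e ≤ A.card * R) (u : V) (t : ℝ) :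
    ∑ v ∈ Finset.univ.erase u, (expLaw r).real {T | fpp T u v ≤ t} ≤
      Real.exp (τ * R * t) / (τ - 1) := by
  have hprob := isProbabilityMeasure_expLaw hr
  have hm : ∀ v, MeasurableSet {T : Sym2 V → ℝ | fpp T u v ≤ t} := fun v =>
    measurableSet_le (measurable_fpp u v) measurable_const
  have hθ0 : 0 < τ * R := mul_pos (by linarith) hR
  have key := lintegral_sum_exp_neg_fpp_le hr hR hτ hΛ u _ {u} (Finset.mem_singleton_self u) rfl
  have hcs : ∀ (T : Sym2 V → ℝ) v, fpp (contract {u} T) u v = fpp T u v := fun T v =>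
    fpp_congr (contract_singleton u) u v
  simp only [hcs, Finset.card_singleton, Nat.cast_one] at key
  rw [lintegral_finsetSum _ (fun v _ =>
    ((measurable_fpp u v).const_mul _).exp.ennreal_ofReal)] at key
  -- Markov's inequality for the discounted count.
  have h1 : ∀ v, expLaw r {T | fpp T u v ≤ t} ≤ ENNReal.ofReal (Real.exp (τ * R * t)) *
      ∫⁻ T, ENNReal.ofReal (Real.exp (-(τ * R) * fpp T u v)) ∂expLaw r := by
    intro v
    rw [← lintegral_indicator_one (hm v), ← lintegral_const_mul' _ _ ENNReal.ofReal_ne_top]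
    refine lintegral_mono fun T => ?_
    by_cases hT : fpp T u v ≤ t
    · rw [Set.indicator_of_mem (by exact hT), ← ENNReal.ofReal_mul (Real.exp_nonneg _),
        ← Real.exp_add, Pi.one_apply, ← ENNReal.ofReal_one]
      refine ENNReal.ofReal_le_ofReal (Real.one_le_exp ?_)
      nlinarith
    · rw [Set.indicator_of_notMem (by exact hT)]
      exact zero_le
  have hcompl : ({u} : Finset V)ᶜ = Finset.univ.erase u := by ext; simp
  rw [hcompl] at key
  have h2 : ∑ v ∈ Finset.univ.erase u, expLaw r {T | fpp T u v ≤ t} ≤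
      ENNReal.ofReal (Real.exp (τ * R * t) / (τ - 1)) := by
    refine (Finset.sum_le_sum fun v _ => h1 v).trans ?_
    rw [← Finset.mul_sum, div_eq_mul_one_div, ENNReal.ofReal_mul (Real.exp_nonneg _)]
    exact mul_le_mul' le_rfl key
  have h3 := ENNReal.toReal_mono ENNReal.ofReal_ne_top h2
  rw [ENNReal.toReal_sum (fun v _ => measure_ne_top _ _), ENNReal.toReal_ofReal
    (div_nonneg (Real.exp_nonneg _) (by linarith))] at h3
  exact h3

end Moments

/-! ### The second moment method. -/

section SecondMoment

variable {X V : Type*} [MeasurableSpace X] {μ : Measure X} [IsProbabilityMeasure μ] [Fintype V]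

open Classical in
/-- Second moment method: bound on an event on which few of the events `a v` happen. -/
theorem measureReal_le_of_second_moment {a : V → Set X} (ha : ∀ v, MeasurableSet (a v))
    {Q : Set X} (hQ : MeasurableSet Q) {M : ℝ} (hM : M = ∑ v, μ.real (a v)) (hM0 : 0 < M) :
    μ.real Q ≤ 4 / M ^ 2 * (∑ v, ∑ w, μ.real (a v ∩ a w) - M ^ 2) +
        2 / M * ∑ v, μ.real (a v ∩ Q) ∧
    μ.real Q ≤ 4 / M ^ 2 * (∑ v, ∑ w, μ.real (a v ∩ a w) - M ^ 2) +
        4 / M ^ 2 * ∑ v, ∑ w, μ.real (a v ∩ a w ∩ Q) := by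
  let I : Set X → X → ℝ := fun s => s.indicator 1
  have hI : ∀ s : Set X, MeasurableSet s → Integrable (I s) μ := fun s hs =>
    (integrable_const (1 : ℝ)).indicator hs
  have hE : ∀ s : Set X, MeasurableSet s → ∫ x, I s x ∂μ = μ.real s := fun s hs =>
    integral_indicator_one hs
  have hmul : ∀ s t : Set X, ∀ x, I (s ∩ t) x = I s x * I t x := fun s t x => by
    simp only [I, Set.inter_indicator_one, Pi.mul_apply]
  let N : X → ℝ := fun x => ∑ v, I (a v) x
  have hN2 : ∀ x, N x ^ 2 = ∑ v, ∑ w, I (a v ∩ a w) x := fun x => by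
    simp only [N, hmul, sq, Finset.sum_mul_sum]
  have hi1 : Integrable N μ := integrable_finsetSum _ fun v _ => hI _ (ha v)
  have hi2 : Integrable (fun x => ∑ v, ∑ w, I (a v ∩ a w) x) μ :=
    integrable_finsetSum _ fun v _ => integrable_finsetSum _ fun w _ =>
      hI _ ((ha v).inter (ha w))
  have hi3 : Integrable (fun x => ∑ v, I (a v ∩ Q) x) μ :=
    integrable_finsetSum _ fun v _ => hI _ ((ha v).inter hQ)
  have hi4 : Integrable (fun x => ∑ v, ∑ w, I (a v ∩ a w ∩ Q) x) μ :=
    integrable_finsetSum _ fun v _ => integrable_finsetSum _ fun w _ =>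
      hI _ (((ha v).inter (ha w)).inter hQ)
  have hiN : Integrable (fun x => (N x - M) ^ 2) μ := by
    have : (fun x => (N x - M) ^ 2) =
        fun x => (∑ v, ∑ w, I (a v ∩ a w) x) - 2 * M * N x + M ^ 2 := by
      ext x; rw [← hN2]; ring
    rw [this]
    exact (hi2.sub (hi1.const_mul _)).add (integrable_const _)
  have hvar : ∫ x, (N x - M) ^ 2 ∂μ = ∑ v, ∑ w, μ.real (a v ∩ a w) - M ^ 2 := by
    have : (fun x => (N x - M) ^ 2) =
        fun x => ((∑ v, ∑ w, I (a v ∩ a w) x) - 2 * M * N x) + M ^ 2 := by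
      ext x; rw [← hN2]; ring
    have hsub : Integrable (fun x => (∑ v, ∑ w, I (a v ∩ a w) x) - 2 * M * N x) μ :=
      hi2.sub (hi1.const_mul _)
    rw [this, integral_add hsub (integrable_const _),
      integral_sub hi2 (hi1.const_mul _), integral_const_mul, integral_const,
      integral_finsetSum _ fun v _ => hI _ (ha v), integral_finsetSum _ fun v _ =>
        integrable_finsetSum _ fun w _ => hI _ ((ha v).inter (ha w))]
    simp only [hE _ (ha _), ← hM]
    have : ∀ v, ∫ x, ∑ w, I (a v ∩ a w) x ∂μ = ∑ w, μ.real (a v ∩ a w) := fun v => by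
      rw [integral_finsetSum _ fun w _ => hI _ ((ha v).inter (ha w))]
      simp only [hE _ ((ha _).inter (ha _))]
    simp only [this, probReal_univ, smul_eq_mul]
    ring
  have hN0 : ∀ x, 0 ≤ N x := fun x => Finset.sum_nonneg fun v _ =>
    Set.indicator_nonneg (fun _ _ => zero_le_one) x
  -- Chebyshev: the variance term pays where N < M/2. Elsewhere 1 ≤ (2/M) N or 1 ≤ (4/M²) N² pays
  -- for the indicator of Q.
  have hbase : ∀ x, N x < M / 2 → 1 ≤ 4 / M ^ 2 * (N x - M) ^ 2 := fun x hx => by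
    rw [div_mul_eq_mul_div, le_div_iff₀ (by positivity)]
    nlinarith
  have hQcases : ∀ x, I Q x = 0 ∨ I Q x = 1 := fun x => by
    by_cases h : x ∈ Q <;> simp [I, h]
  rw [← hvar, ← hE Q hQ]
  constructor
  · have h1 : ∑ v, μ.real (a v ∩ Q) = ∫ x, ∑ v, I (a v ∩ Q) x ∂μ := by
      rw [integral_finsetSum _ fun v _ => hI _ ((ha v).inter hQ)]
      simp only [hE _ ((ha _).inter hQ)]
    rw [h1, ← integral_const_mul, ← integral_const_mul,
      ← integral_add (hiN.const_mul _) (hi3.const_mul _)]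
    refine integral_mono (hI Q hQ) ((hiN.const_mul _).add (hi3.const_mul _)) fun x => ?_
    have h2 : ∑ v, I (a v ∩ Q) x = N x * I Q x := by
      simp only [hmul, N, Finset.sum_mul]
    simp only [h2]
    have h3 : 0 ≤ 4 / M ^ 2 * (N x - M) ^ 2 := by positivity
    rcases hQcases x with h | h <;> rw [h]
    · linarith
    · by_cases hx : N x < M / 2
      · have := hbase x hx
        have : 0 ≤ 2 / M * (N x * 1) := mul_nonneg (by positivity) (by linarith [hN0 x])
        linarith
      · have : 1 ≤ 2 / M * (N x * 1) := by
          rw [div_mul_eq_mul_div, le_div_iff₀ hM0]; linarith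
        linarith
  · have h1 : ∑ v, ∑ w, μ.real (a v ∩ a w ∩ Q) = ∫ x, ∑ v, ∑ w, I (a v ∩ a w ∩ Q) x ∂μ := by
      rw [integral_finsetSum _ fun v _ => integrable_finsetSum _ fun w _ =>
        hI _ (((ha v).inter (ha w)).inter hQ)]
      refine Finset.sum_congr rfl fun v _ => ?_
      rw [integral_finsetSum _ fun w _ => hI _ (((ha v).inter (ha w)).inter hQ)]
      simp only [hE _ (((ha _).inter (ha _)).inter hQ)]
    rw [h1, ← integral_const_mul, ← integral_const_mul,
      ← integral_add (hiN.const_mul _) (hi4.const_mul _)]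
    refine integral_mono (hI Q hQ) ((hiN.const_mul _).add (hi4.const_mul _)) fun x => ?_
    have h2 : ∑ v, ∑ w, I (a v ∩ a w ∩ Q) x = N x ^ 2 * I Q x := by
      rw [hN2, Finset.sum_mul]
      refine Finset.sum_congr rfl fun v _ => ?_
      rw [Finset.sum_mul]
      exact Finset.sum_congr rfl fun w _ => hmul _ _ _
    simp only [h2]
    have h3 : 0 ≤ 4 / M ^ 2 * (N x - M) ^ 2 := by positivity
    rcases hQcases x with h | h <;> rw [h]
    · linarith
    · by_cases hx : N x < M / 2
      · have := hbase x hx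
        have : 0 ≤ 4 / M ^ 2 * (N x ^ 2 * 1) := by positivity
        linarith
      · have : 1 ≤ 4 / M ^ 2 * (N x ^ 2 * 1) := by
          rw [div_mul_eq_mul_div, le_div_iff₀ (by positivity)]; nlinarith
        linarith

end SecondMoment

/-! ### Isolated vertices and lower bounds for flooding time and diameter. -/

section LowerBounds

variable {V : Type*} [Fintype V] [DecidableEq V] {r : Sym2 V → ℝ}

theorem expLaw_real_forall_le_inter_shift {ι : Type*} [Fintype ι] [DecidableEq ι] {r : ι → ℝ}
    (hr : ∀ i, 0 < r i) (J : Finset ι) {s : ℝ} (hs : 0 ≤ s) {S : Set (ι → ℝ)}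
    (hS : MeasurableSet S) :
    (expLaw r).real ({T | ∀ i ∈ J, s ≤ T i} ∩ shift J s ⁻¹' S) =
      Real.exp (-(s * ∑ i ∈ J, r i)) * (expLaw r).real S := by
  have h := setLIntegral_shift hr J hs (Ψ := S.indicator 1) (measurable_one.indicator hS)
  rw [lintegral_indicator_one hS] at h
  have h2 : ∀ T, S.indicator (1 : (ι → ℝ) → ℝ≥0∞) (shift J s T) =
      (shift J s ⁻¹' S).indicator 1 T := fun T => rfl
  simp only [h2] at h
  rw [lintegral_indicator_one (measurable_shift J s hS),
    Measure.restrict_apply (measurable_shift J s hS)] at h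
  rw [Set.inter_comm, measureReal_def, h, ENNReal.toReal_mul,
    ENNReal.toReal_ofReal (Real.exp_nonneg _), measureReal_def]

theorem expLaw_real_forall_le {ι : Type*} [Fintype ι] [DecidableEq ι] {r : ι → ℝ}
    (hr : ∀ i, 0 < r i) (J : Finset ι) {s : ℝ} (hs : 0 ≤ s) :
    (expLaw r).real {T | ∀ i ∈ J, s ≤ T i} = Real.exp (-(s * ∑ i ∈ J, r i)) := by
  have := isProbabilityMeasure_expLaw hr
  simpa using expLaw_real_forall_le_inter_shift hr J hs MeasurableSet.univ

theorem expLaw_real_eval_le {ι : Type*} [Fintype ι] {r : ι → ℝ}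
    (hr : ∀ i, 0 < r i) (i : ι) {t : ℝ} (ht : 0 ≤ t) :
    (expLaw r).real {T | T i ≤ t} ≤ r i * t := by
  have := fun i => isProbabilityMeasure_expMeasure (hr i)
  have h := (measurePreserving_eval (fun i => expMeasure (r i)) i).measure_preimage
    (measurableSet_Iic (a := t)).nullMeasurableSet
  have h1 := h.le.trans (expMeasure_Iic_le (hr i) t ht)
  exact ENNReal.toReal_le_of_le_ofReal (mul_nonneg (hr i).le ht) h1

/-- The edge vw is the only one common to both boundaries. It is the sole source of correlation
between the isolation of v and that of w. -/
theorem sum_boundary_union_ge {R : ℝ} (hR : ∀ v, ∑ e ∈ boundary {v}, r e = R)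
    {v w : V} (hvw : v ≠ w) (h1 : r s(v, w) ≤ 1) :
    2 * R - 1 ≤ ∑ e ∈ boundary {v} ∪ boundary {w}, r e := by
  have h := Finset.sum_union_inter (s₁ := boundary {v}) (s₂ := boundary {w}) (f := r)
  have h2 : boundary {v} ∩ boundary {w} = {s(v, w)} := by
    ext e
    induction e with
    | _ x y =>
      simp only [Finset.mem_inter, mk_mem_boundary, Finset.mem_singleton, Sym2.eq_iff]
      grind
  rw [h2, Finset.sum_singleton, hR, hR] at h
  linarith

variable {R τ : ℝ}

/-- The diagonal pairs v = w give the first term; the others carry exp(-s(2R - 1)), the square of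
the isolation probability times exp(s). -/
theorem sum_sum_far_le [Nonempty V] (hr : ∀ e, 0 < r e)
    (hR : ∀ v, ∑ e ∈ boundary {v}, r e = R) {s : ℝ} (hs : 0 ≤ s) {Q : Set (Sym2 V → ℝ)} {c : ℝ}
    (hQ : ∀ v, ∑ w ∈ Finset.univ.erase v, (expLaw r).real (({T | ∀ f ∈ boundary {v}, s ≤ T f} ∩
        {T | ∀ f ∈ boundary {w}, s ≤ T f}) ∩ Q) ≤ Real.exp (-(s * (2 * R - 1))) * c) :
    ∑ v, ∑ w, (expLaw r).real (({T | ∀ f ∈ boundary {v}, s ≤ T f} ∩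
        {T | ∀ f ∈ boundary {w}, s ≤ T f}) ∩ Q) ≤
      Fintype.card V * Real.exp (-(s * R)) +
        Fintype.card V * (Real.exp (-(s * R)) ^ 2 * Real.exp s * c) := by
  have hprob := isProbabilityMeasure_expLaw hr
  rw [← mul_add, ← nsmul_eq_mul]
  refine Finset.sum_le_card_nsmul _ _ _ fun v _ => ?_
  rw [← Finset.add_sum_erase _ _ (Finset.mem_univ v)]
  refine add_le_add ?_ ((hQ v).trans (le_of_eq ?_))
  · rw [← hR v, ← expLaw_real_forall_le hr _ hs, Set.inter_self]
    exact measureReal_mono Set.inter_subset_left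
  · rw [← Real.exp_nat_mul, ← Real.exp_add]
    congr 2
    push_cast
    ring

/-- The relative variance of the number of isolated vertices is at most 1/M from the diagonal plus
exp(s) - 1 from the shared edges. Both vanish once M → ∞ and s → 0. -/
theorem far_variance_le [Nonempty V] (hr : ∀ e, 0 < r e)
    (hr1 : ∀ v w, v ≠ w → r s(v, w) ≤ 1)
    (hR : ∀ v, ∑ e ∈ boundary {v}, r e = R) {s : ℝ} (hs : 0 ≤ s) {M : ℝ}
    (hM : M = Fintype.card V * Real.exp (-(s * R))) :
    4 / M ^ 2 * (∑ v, ∑ w, (expLaw r).real ({T | ∀ f ∈ boundary {v}, s ≤ T f} ∩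
        {T | ∀ f ∈ boundary {w}, s ≤ T f}) - M ^ 2) ≤ 4 * (M⁻¹ + Real.exp s - 1) := by
  have hprob := isProbabilityMeasure_expLaw hr
  have hn : (0 : ℝ) < Fintype.card V := by exact_mod_cast Fintype.card_pos
  have hM0 : 0 < M := hM ▸ by positivity
  have key := sum_sum_far_le hr hR hs (Q := Set.univ) (c := Fintype.card V) (fun v => by
    have h1 : ∀ w ∈ Finset.univ.erase v, (expLaw r).real (({T | ∀ f ∈ boundary {v}, s ≤ T f} ∩
        {T | ∀ f ∈ boundary {w}, s ≤ T f}) ∩ Set.univ) ≤ Real.exp (-(s * (2 * R - 1))) := by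
      intro w hw
      have hvw : v ≠ w := (Finset.ne_of_mem_erase hw).symm
      have hset : (({T : Sym2 V → ℝ | ∀ f ∈ boundary {v}, s ≤ T f} ∩
          {T | ∀ f ∈ boundary {w}, s ≤ T f}) ∩ Set.univ) =
          {T | ∀ f ∈ boundary {v} ∪ boundary {w}, s ≤ T f} := by
        ext T
        simp only [Set.inter_univ, Set.mem_inter_iff, Set.mem_ofPred_eq, Finset.mem_union,
          or_imp, forall_and]
      rw [hset, expLaw_real_forall_le hr _ hs]
      refine Real.exp_le_exp.mpr (neg_le_neg (mul_le_mul_of_nonneg_left ?_ hs))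
      exact sum_boundary_union_ge hR hvw (hr1 v w hvw)
    refine (Finset.sum_le_card_nsmul _ _ _ h1).trans ?_
    rw [nsmul_eq_mul, mul_comm]
    refine mul_le_mul_of_nonneg_left ?_ (Real.exp_nonneg _)
    exact_mod_cast Finset.card_le_univ _)
  simp only [Set.inter_univ] at key
  rw [div_mul_eq_mul_div, div_le_iff₀ (by positivity)]
  have h2 : 4 * (M⁻¹ + Real.exp s - 1) * M ^ 2 = 4 * (M + M ^ 2 * Real.exp s - M ^ 2) := by
    field_simp
  rw [h2]
  have h3 : (Fintype.card V : ℝ) * (Real.exp (-(s * R)) ^ 2 * Real.exp s * Fintype.card V) =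
      M ^ 2 * Real.exp s := by rw [hM]; ring
  rw [← hM, h3] at key
  linarith

/-- It is unlikely that all vertices are within distance `s + t` of `u`. -/
theorem flooding_lower_bound (hr : ∀ e, 0 < r e) (hr1 : ∀ v w, v ≠ w → r s(v, w) ≤ 1)
    (hR0 : 0 < R) (hR : ∀ v, ∑ e ∈ boundary {v}, r e = R)
    (hΛ : ∀ A : Finset V, ∑ e ∈ boundary A, r e ≤ A.card * R) (hτ : 1 < τ)
    {s t : ℝ} (hs : 0 ≤ s) (u : V) {M : ℝ} (hM : M = Fintype.card V * Real.exp (-(s * R))) :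
    (expLaw r).real {T | ∀ v, fpp T u v ≤ s + t} ≤ 4 * (M⁻¹ + Real.exp s - 1) +
      2 * (1 + Real.exp (τ * R * t) / (τ - 1)) / Fintype.card V := by
  have hprob := isProbabilityMeasure_expLaw hr
  have : Nonempty V := ⟨u⟩
  have hn : (0 : ℝ) < Fintype.card V := by exact_mod_cast Fintype.card_pos
  have hM0 : 0 < M := hM ▸ by positivity
  have hQ : MeasurableSet {T : Sym2 V → ℝ | ∀ v, fpp T u v ≤ s + t} := by
    rw [show {T : Sym2 V → ℝ | ∀ v, fpp T u v ≤ s + t} = ⋂ v, {T | fpp T u v ≤ s + t} by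
      ext; simp]
    exact MeasurableSet.iInter fun v => measurableSet_le (measurable_fpp u v) measurable_const
  have hMsum : M = ∑ v : V, (expLaw r).real {T | ∀ f ∈ boundary {v}, s ≤ T f} := by
    simp [expLaw_real_forall_le hr _ hs, hR, hM]
  refine (measureReal_le_of_second_moment (fun v => measurableSet_forall_le _ _) hQ hMsum
    hM0).1.trans (add_le_add (far_variance_le hr hr1 hR hs hM) ?_)
  -- If v is isolated up to s and still within s + t of u, then v is within t of u for the shifted
  -- weights, which given isolation have the original law.
  have h1 : ∀ v ∈ Finset.univ.erase u, (expLaw r).real ({T | ∀ f ∈ boundary {v}, s ≤ T f} ∩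
      {T | ∀ v, fpp T u v ≤ s + t}) ≤
      Real.exp (-(s * R)) * (expLaw r).real {T | fpp T u v ≤ t} := by
    intro v hv
    rw [← hR v, ← expLaw_real_forall_le_inter_shift hr _ hs
      (measurableSet_le (measurable_fpp u v) measurable_const)]
    refine ENNReal.toReal_mono (measure_ne_top _ _) (measure_mono_ae ?_)
    filter_upwards [expLaw_ae_nonneg hr] with T hT hTm
    have h2 := shift_boundary_add_le_fpp hT hs (Finset.ne_of_mem_erase hv).symm hTm.1
    have h3 := hTm.2 v
    exact ⟨hTm.1, show fpp _ u v ≤ t by linarith⟩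
  rw [← Finset.add_sum_erase _ _ (Finset.mem_univ u)]
  -- The vertex u itself is bounded trivially; it accounts for the summand 1 in the statement.
  have h2 : (expLaw r).real ({T | ∀ f ∈ boundary {u}, s ≤ T f} ∩
      {T | ∀ v, fpp T u v ≤ s + t}) ≤ Real.exp (-(s * R)) := by
    rw [← hR u, ← expLaw_real_forall_le hr _ hs]
    exact measureReal_mono Set.inter_subset_left
  have h3 := Finset.sum_le_sum h1
  rw [← Finset.mul_sum] at h3
  have h4 := mul_le_mul_of_nonneg_left (sum_measure_fpp_le hr hR0 hτ hΛ u t)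
    (Real.exp_nonneg (-(s * R)))
  calc _ ≤ 2 / M * (Real.exp (-(s * R)) + Real.exp (-(s * R)) *
        (Real.exp (τ * R * t) / (τ - 1))) :=
        mul_le_mul_of_nonneg_left (by linarith) (by positivity)
    _ = _ := by rw [hM]; field_simp

/-- It is unlikely that all vertices are within distance `2 * s + t` of each other. -/
theorem diameter_lower_bound [Nonempty V] (hr : ∀ e, 0 < r e)
    (hr1 : ∀ v w, v ≠ w → r s(v, w) ≤ 1)
    (hR0 : 0 < R) (hR : ∀ v, ∑ e ∈ boundary {v}, r e = R)
    (hΛ : ∀ A : Finset V, ∑ e ∈ boundary A, r e ≤ A.card * R) (hτ : 1 < τ)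
    {s t : ℝ} (hs : 0 ≤ s) (ht : 0 ≤ t) {M : ℝ}
    (hM : M = Fintype.card V * Real.exp (-(s * R))) :
    (expLaw r).real {T | ∀ v w, fpp T v w ≤ 2 * s + t} ≤ 4 * (M⁻¹ + Real.exp s - 1) +
      (4 * M⁻¹ + 4 * Real.exp s * (Real.exp (τ * R * t) / (τ - 1) + R * (s + t)) /
        Fintype.card V) := by
  have hprob := isProbabilityMeasure_expLaw hr
  have hn : (0 : ℝ) < Fintype.card V := by exact_mod_cast Fintype.card_pos
  have hM0 : 0 < M := hM ▸ by positivity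
  have hQ : MeasurableSet {T : Sym2 V → ℝ | ∀ v w, fpp T v w ≤ 2 * s + t} := by
    rw [show {T : Sym2 V → ℝ | ∀ v w, fpp T v w ≤ 2 * s + t} =
      ⋂ v, ⋂ w, {T | fpp T v w ≤ 2 * s + t} by ext; simp]
    exact MeasurableSet.iInter fun v => MeasurableSet.iInter fun w =>
      measurableSet_le (measurable_fpp v w) measurable_const
  have hMsum : M = ∑ v : V, (expLaw r).real {T | ∀ f ∈ boundary {v}, s ≤ T f} := by
    simp [expLaw_real_forall_le hr _ hs, hR, hM]
  refine (measureReal_le_of_second_moment (fun v => measurableSet_forall_le _ _) hQ hMsum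
    hM0).2.trans (add_le_add (far_variance_le hr hr1 hR hs hM) ?_)
  have h1 : ∀ v, ∀ w ∈ Finset.univ.erase v, (expLaw r).real (({T | ∀ f ∈ boundary {v}, s ≤ T f} ∩
        {T | ∀ f ∈ boundary {w}, s ≤ T f}) ∩ {T | ∀ v w, fpp T v w ≤ 2 * s + t}) ≤
      Real.exp (-(s * (2 * R - 1))) *
        ((expLaw r).real {T | fpp T v w ≤ t} + r s(v, w) * (s + t)) := by
    intro v w hw
    have hvw : v ≠ w := (Finset.ne_of_mem_erase hw).symm
    -- The second event covers a direct edge vw, shortened by s only once. Its probability is at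
    -- most r(vw)(s + t), which sums to R(s + t) over w.
    have hS : MeasurableSet ({T : Sym2 V → ℝ | fpp T v w ≤ t} ∪ {T | T s(v, w) ≤ s + t}) :=
      (measurableSet_le (measurable_fpp v w) measurable_const).union
        (measurableSet_le (measurable_pi_apply _) measurable_const)
    calc _ ≤ (expLaw r).real ({T | ∀ f ∈ boundary {v} ∪ boundary {w}, s ≤ T f} ∩
          shift (boundary {v} ∪ boundary {w}) s ⁻¹'
            ({T | fpp T v w ≤ t} ∪ {T | T s(v, w) ≤ s + t})) := by
          refine ENNReal.toReal_mono (measure_ne_top _ _) (measure_mono_ae ?_)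
          filter_upwards [expLaw_ae_nonneg hr] with T hT hTm
          have hJ : ∀ f ∈ boundary {v} ∪ boundary {w}, s ≤ T f := fun f hf =>
            (Finset.mem_union.mp hf).elim (hTm.1.1 f) (hTm.1.2 f)
          have h2 := shift_boundary_union_add_le_fpp hT hs hvw hJ
          have h3 := hTm.2 v w
          refine ⟨hJ, ?_⟩
          rcases min_le_iff.mp h2 with h | h
          · exact Or.inl (show fpp _ v w ≤ t by linarith)
          · exact Or.inr (show shift _ s T s(v, w) ≤ s + t by linarith)
      _ ≤ Real.exp (-(s * (2 * R - 1))) *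
          (expLaw r).real ({T | fpp T v w ≤ t} ∪ {T | T s(v, w) ≤ s + t}) := by
          rw [expLaw_real_forall_le_inter_shift hr _ hs hS]
          refine mul_le_mul_of_nonneg_right (Real.exp_le_exp.mpr (neg_le_neg
            (mul_le_mul_of_nonneg_left ?_ hs))) measureReal_nonneg
          exact sum_boundary_union_ge hR hvw (hr1 v w hvw)
      _ ≤ _ := by
          refine mul_le_mul_of_nonneg_left ((measureReal_union_le _ _).trans
            (add_le_add le_rfl ?_)) (Real.exp_nonneg _)
          exact expLaw_real_eval_le hr _ (by linarith)
  have hrow : ∀ v, ∑ w ∈ Finset.univ.erase v, r s(v, w) = R := fun v => by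
    rw [← hR v, sum_boundary, Finset.sum_singleton]
    congr 1
    ext; simp
  have key := sum_sum_far_le hr hR hs (Q := {T | ∀ v w, fpp T v w ≤ 2 * s + t})
    (c := Real.exp (τ * R * t) / (τ - 1) + R * (s + t)) (fun v => by
      refine (Finset.sum_le_sum (h1 v)).trans ?_
      rw [← Finset.mul_sum, Finset.sum_add_distrib, ← Finset.sum_mul, hrow]
      exact mul_le_mul_of_nonneg_left (add_le_add (sum_measure_fpp_le hr hR0 hτ hΛ v t) le_rfl)
        (Real.exp_nonneg _))
  refine (mul_le_mul_of_nonneg_left key (by positivity)).trans (le_of_eq ?_)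
  have hτ' : τ - 1 ≠ 0 := by linarith
  rw [hM]
  field_simp

end LowerBounds

/-! ### One-dimensional power sums. -/

section PowerSums

/-- Induction: Bernoulli's inequality for (1 - 1/(k+1))^(1-β) bounds the new term by the increment
of k^(1-β)/(1-β). -/
theorem sum_range_rpow_neg_le {β : ℝ} (hβ0 : 0 ≤ β) (hβ : β < 1) (k : ℕ) :
    ∑ j ∈ Finset.range k, ((j : ℝ) + 1) ^ (-β) ≤ (k : ℝ) ^ (1 - β) / (1 - β) := by
  have hb : 0 < 1 - β := by linarith
  induction k with
  | zero => simp [Real.zero_rpow hb.ne']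
  | succ k ih =>
    rw [Finset.sum_range_succ]
    have hk : (0 : ℝ) < k + 1 := by positivity
    have h1 : (1 + -(1 / ((k : ℝ) + 1))) ^ (1 - β) ≤ 1 + (1 - β) * -(1 / ((k : ℝ) + 1)) := by
      refine rpow_one_add_le_one_add_mul_self ?_ hb.le (by linarith)
      rw [neg_le_neg_iff, div_le_one hk]
      linarith [(Nat.cast_nonneg k : (0 : ℝ) ≤ k)]
    have h2 : 1 + -(1 / ((k : ℝ) + 1)) = k / (k + 1) := by field_simp; ring
    rw [h2, Real.div_rpow (Nat.cast_nonneg k) hk.le,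
      div_le_iff₀ (Real.rpow_pos_of_pos hk _)] at h1
    have h3 : ((k : ℝ) + 1) ^ (1 - β) = (k + 1) * (k + 1) ^ (-β) := by
      rw [sub_eq_add_neg, Real.rpow_add hk, Real.rpow_one]
    have h4 : (1 + (1 - β) * -(1 / ((k : ℝ) + 1))) * ((k : ℝ) + 1) ^ (1 - β) =
        (k + 1) ^ (1 - β) - (1 - β) * ((k : ℝ) + 1) ^ (-β) := by
      rw [h3]; field_simp; ring
    rw [h4] at h1
    rw [le_div_iff₀ hb] at ih ⊢
    push_cast
    nlinarith

theorem sum_range_max_one_rpow_neg_le {β : ℝ} (hβ0 : 0 ≤ β) (hβ : β < 1) {k : ℕ} (hk : 1 ≤ k) :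
    ∑ j ∈ Finset.range (k + 1), (max 1 (j : ℝ)) ^ (-β) ≤ 2 / (1 - β) * (k : ℝ) ^ (1 - β) := by
  have hb : 0 < 1 - β := by linarith
  have hk1 : (1 : ℝ) ≤ k := by exact_mod_cast hk
  rw [Finset.sum_range_succ']
  have h1 : ∀ j : ℕ, (max 1 ((j + 1 : ℕ) : ℝ)) = (j : ℝ) + 1 := fun j => by
    push_cast
    exact max_eq_right (by linarith [(Nat.cast_nonneg j : (0 : ℝ) ≤ j)])
  simp only [h1]
  have h2 := sum_range_rpow_neg_le hβ0 hβ k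
  have h3 : (1 : ℝ) ≤ (k : ℝ) ^ (1 - β) / (1 - β) := by
    rw [le_div_iff₀ hb]
    linarith [Real.one_le_rpow hk1 hb.le]
  have h4 : 2 / (1 - β) * (k : ℝ) ^ (1 - β) =
      (k : ℝ) ^ (1 - β) / (1 - β) + (k : ℝ) ^ (1 - β) / (1 - β) := by ring
  rw [h4]
  simpa using add_le_add h2 h3

end PowerSums

/-! ### The torus norm and sums of its negative powers. -/

section TorusNorm

variable {d m : ℕ} {p : ℝ≥0∞}

theorem abs_apply_le_latticeNorm (hp : 1 ≤ p) (x : Fin d → ℤ) (i : Fin d) :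
    |(x i : ℝ)| ≤ latticeNorm p x := by
  have : Fact (1 ≤ p) := ⟨hp⟩
  exact PiLp.norm_apply_le (WithLp.toLp p (fun i => (x i : ℝ)) : PiLp p (fun _ : Fin d => ℝ)) i

theorem latticeNorm_le_sum (hp : 1 ≤ p) (x : Fin d → ℤ) :
    latticeNorm p x ≤ ∑ i, |(x i : ℝ)| := by
  have : Fact (1 ≤ p) := ⟨hp⟩
  have h : (WithLp.toLp p (fun i => (x i : ℝ)) : PiLp p (fun _ : Fin d => ℝ)) =
      ∑ i, WithLp.toLp p (Pi.single i (x i : ℝ)) := by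
    rw [← WithLp.toLp_sum, Finset.univ_sum_single]
  unfold latticeNorm
  rw [h]
  refine (norm_sum_le _ _).trans (le_of_eq (Finset.sum_congr rfl fun i _ => ?_))
  exact PiLp.norm_single p (fun _ : Fin d => ℝ) i _

theorem latticeNorm_nonneg (hp : 1 ≤ p) (x : Fin d → ℤ) : 0 ≤ latticeNorm p x := by
  have : Fact (1 ≤ p) := ⟨hp⟩
  exact norm_nonneg (WithLp.toLp p (fun i => (x i : ℝ)) : PiLp p (fun _ : Fin d => ℝ))

/-- The representative with coordinates of least absolute value. -/
def minLift (u : Torus d m) : Lift u := ⟨fun i => (u i).valMinAbs, fun i => (u i).coe_valMinAbs⟩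

theorem natAbs_valMinAbs_le_of_cast_eq [NeZero m] {a : ZMod m} {x : ℤ} (h : (x : ZMod m) = a) :
    a.valMinAbs.natAbs ≤ x.natAbs := by
  by_contra! hlt
  have hle := a.natAbs_valMinAbs_le
  have hx : a.valMinAbs = x := (ZMod.valMinAbs_spec a x).mpr
    ⟨h.symm, by constructor <;> omega⟩
  omega

theorem natAbs_le_torusNorm [NeZero m] (hp : 1 ≤ p) (u : Torus d m) (i : Fin d) :
    ((u i).valMinAbs.natAbs : ℝ) ≤ torusNorm p u := by
  have : Nonempty (Lift u) := ⟨minLift u⟩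
  refine le_ciInf fun x => ?_
  refine le_trans ?_ (abs_apply_le_latticeNorm hp x.1 i)
  rw [← Int.cast_abs, ← Nat.cast_natAbs]
  exact_mod_cast natAbs_valMinAbs_le_of_cast_eq (x.2 i)

theorem torusNorm_le [NeZero m] (hp : 1 ≤ p) (u : Torus d m) : torusNorm p u ≤ d * m := by
  refine (ciInf_le ⟨0, ?_⟩ (minLift u)).trans ((latticeNorm_le_sum hp _).trans ?_)
  · rintro _ ⟨x, rfl⟩
    exact latticeNorm_nonneg hp _
  · refine (Finset.sum_le_card_nsmul _ _ (m : ℝ) fun i _ => ?_).trans (by simp)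
    rw [← Int.cast_abs, ← Nat.cast_natAbs]
    have h : (u i).valMinAbs.natAbs ≤ m := (u i).natAbs_valMinAbs_le.trans (Nat.div_le_self m 2)
    exact_mod_cast h

theorem one_le_torusNorm [NeZero m] (hp : 1 ≤ p) {u : Torus d m} (hu : u ≠ 0) :
    1 ≤ torusNorm p u := by
  obtain ⟨i, hi⟩ := Function.ne_iff.mp hu
  have h : 1 ≤ (u i).valMinAbs.natAbs := by
    rw [Nat.one_le_iff_ne_zero, Ne, Int.natAbs_eq_zero, ZMod.valMinAbs_eq_zero]
    exact hi
  exact le_trans (by exact_mod_cast h) (natAbs_le_torusNorm hp u i)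

variable {α : ℝ}

/-- The norm dominates every coordinate, so sharing the exponent α equally factorises the
d-dimensional sum into one-dimensional sums of exponent α/d < 1. The maximum with 1 handles zero
coordinates. -/
theorem torusNorm_rpow_neg_le_prod [NeZero m] (hp : 1 ≤ p) (hd : 0 < d) (hα0 : 0 ≤ α)
    {u : Torus d m} (hu : u ≠ 0) :
    torusNorm p u ^ (-α) ≤ ∏ i, (max 1 ((u i).valMinAbs.natAbs : ℝ)) ^ (-(α / d)) := by
  have h1 := one_le_torusNorm hp hu
  have hd' : (d : ℝ) ≠ 0 := by positivity
  calc torusNorm p u ^ (-α) = ∏ _i : Fin d, torusNorm p u ^ (-(α / d)) := by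
        rw [Finset.prod_const, Finset.card_univ, Fintype.card_fin, ← Real.rpow_natCast,
          ← Real.rpow_mul (by linarith)]
        congr 1
        field_simp
    _ ≤ _ := by
        refine Finset.prod_le_prod (fun i _ => Real.rpow_nonneg (by linarith) _) fun i _ => ?_
        exact Real.rpow_le_rpow_of_nonpos (by positivity)
          (max_le h1 (natAbs_le_torusNorm hp u i)) (neg_nonpos.mpr (by positivity))

theorem sum_natAbs_le [NeZero m] {β : ℝ} (hβ0 : 0 ≤ β) (hβ : β < 1) {k : ℕ} (hk : 1 ≤ k) :
    ∑ z : ZMod m with z.valMinAbs.natAbs ≤ k, (max 1 (z.valMinAbs.natAbs : ℝ)) ^ (-β) ≤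
      4 / (1 - β) * (k : ℝ) ^ (1 - β) := by
  rw [← Finset.sum_fiberwise_of_maps_to (s := Finset.univ.filter fun z : ZMod m =>
    z.valMinAbs.natAbs ≤ k) (t := Finset.range (k + 1)) (g := fun z => z.valMinAbs.natAbs)
    (fun z hz => Finset.mem_range.mpr (Nat.lt_succ_of_le (Finset.mem_filter.mp hz).2))]
  have h1 : ∀ j ∈ Finset.range (k + 1), ∑ z ∈ (Finset.univ.filter fun z : ZMod m =>
      z.valMinAbs.natAbs ≤ k) with z.valMinAbs.natAbs = j,
        (max 1 (z.valMinAbs.natAbs : ℝ)) ^ (-β) ≤ 2 * (max 1 (j : ℝ)) ^ (-β) := by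
    intro j _
    rw [Finset.sum_congr rfl (g := fun _ => (max 1 (j : ℝ)) ^ (-β)) (fun z hz => by
      rw [(Finset.mem_filter.mp hz).2]), Finset.sum_const, nsmul_eq_mul]
    refine mul_le_mul_of_nonneg_right ?_ (by positivity)
    have hsub : ((Finset.univ.filter fun z : ZMod m => z.valMinAbs.natAbs ≤ k).filter
        fun z => z.valMinAbs.natAbs = j) ⊆ {(j : ZMod m), -(j : ZMod m)} := by
      intro z hz
      have hzj := (Finset.mem_filter.mp hz).2
      rw [Finset.mem_insert, Finset.mem_singleton]
      have hz' := z.coe_valMinAbs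
      rcases Int.natAbs_eq_iff.mp hzj with h | h
      · left; rw [← hz', h]; simp
      · right; rw [← hz', h]; simp
    exact_mod_cast (Finset.card_le_card hsub).trans Finset.card_le_two
  refine (Finset.sum_le_sum h1).trans ?_
  rw [← Finset.mul_sum]
  have h2 := sum_range_max_one_rpow_neg_le hβ0 hβ hk
  calc _ ≤ 2 * (2 / (1 - β) * (k : ℝ) ^ (1 - β)) := mul_le_mul_of_nonneg_left h2 (by norm_num)
    _ = _ := by ring

/-- The contribution of a set `A` to the sum of `‖x - y‖ ^ (-α)`. -/
theorem sum_torusNorm_sub_le [NeZero m] (hp : 1 ≤ p) (hd : 0 < d) (hα0 : 0 ≤ α) (hαd : α < d)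
    (A : Finset (Torus d m)) (x : Torus d m) {k : ℕ} (hk : 1 ≤ k) :
    ∑ y ∈ A.erase x, torusNorm p (x - y) ^ (-α) ≤
      (4 / (1 - α / d)) ^ d * (k : ℝ) ^ ((d : ℝ) - α) + A.card * (k : ℝ) ^ (-α) := by
  have hd' : (0 : ℝ) < d := by exact_mod_cast hd
  have hβ : α / d < 1 := (div_lt_one hd').mpr hαd
  have hβ0 : 0 ≤ α / d := by positivity
  have hk0 : (0 : ℝ) < k := by exact_mod_cast hk
  set S := Finset.univ.filter fun z : ZMod m => z.valMinAbs.natAbs ≤ k with hS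
  set F : Torus d m → ℝ := fun u => ∏ i, (max 1 ((u i).valMinAbs.natAbs : ℝ)) ^ (-(α / d))
  have hF0 : ∀ u, 0 ≤ F u := fun u => Finset.prod_nonneg fun i _ => by positivity
  let G : Torus d m → ℝ := fun u => if u ∈ Fintype.piFinset fun _ : Fin d => S then F u else 0
  have hG0 : ∀ u, 0 ≤ G u := fun u => by
    simp only [G]; split_ifs
    exacts [hF0 u, le_rfl]
  -- Points in the box of radius k around x are charged to the full box sum; any other point has
  -- norm at least k.
  have h1 : ∀ y ∈ A.erase x, torusNorm p (x - y) ^ (-α) ≤ G (x - y) + (k : ℝ) ^ (-α) := by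
    intro y hy
    have hne : x - y ≠ 0 := sub_ne_zero.mpr (Finset.ne_of_mem_erase hy).symm
    by_cases h : x - y ∈ Fintype.piFinset fun _ : Fin d => S
    · have := torusNorm_rpow_neg_le_prod hp hd hα0 hne
      simp only [G, if_pos h]
      have : 0 ≤ (k : ℝ) ^ (-α) := by positivity
      linarith
    · simp only [G, if_neg h, zero_add]
      simp only [Fintype.mem_piFinset, hS, Finset.mem_filter, Finset.mem_univ, true_and,
        not_forall, not_le] at h
      obtain ⟨i, hi⟩ := h
      refine Real.rpow_le_rpow_of_nonpos hk0 ?_ (by linarith)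
      exact le_trans (by exact_mod_cast hi.le) (natAbs_le_torusNorm hp (x - y) i)
  refine (Finset.sum_le_sum h1).trans ?_
  rw [Finset.sum_add_distrib, Finset.sum_const, nsmul_eq_mul]
  refine add_le_add ?_ (mul_le_mul_of_nonneg_right
    (by exact_mod_cast Finset.card_erase_le) (by positivity))
  calc ∑ y ∈ A.erase x, G (x - y) ≤ ∑ y, G (x - y) :=
        Finset.sum_le_sum_of_subset_of_nonneg (Finset.subset_univ _) fun y _ _ => hG0 _
    _ = ∑ u, G u := Equiv.sum_comp (Equiv.subLeft x) G
    _ = ∑ u ∈ Fintype.piFinset fun _ : Fin d => S, F u := by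
        simp only [G, Finset.sum_ite_mem, Finset.univ_inter]
    _ = ∏ _i : Fin d, ∑ z ∈ S, (max 1 (z.valMinAbs.natAbs : ℝ)) ^ (-(α / d)) :=
        Finset.sum_prod_piFinset S fun _ z => (max 1 (z.valMinAbs.natAbs : ℝ)) ^ (-(α / d))
    _ = (∑ z ∈ S, (max 1 (z.valMinAbs.natAbs : ℝ)) ^ (-(α / d))) ^ d := by simp
    _ ≤ (4 / (1 - α / d) * (k : ℝ) ^ (1 - α / d)) ^ d :=
        pow_le_pow_left₀ (Finset.sum_nonneg fun z _ => by positivity)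
          (sum_natAbs_le hβ0 hβ hk) d
    _ = _ := by
        rw [mul_pow, ← Real.rpow_natCast ((k : ℝ) ^ (1 - α / d)), ← Real.rpow_mul hk0.le]
        congr 2
        field_simp

end TorusNorm

/-! ### Edge rates and the order of magnitude of R. -/

section Rates

variable {d m : ℕ} {p : ℝ≥0∞} {α : ℝ}

/-- The rate of the weight of an edge (equal to one on the diagonal, which carries no edges). -/
noncomputable def rate (p : ℝ≥0∞) (α : ℝ) (e : Sym2 (Torus d m)) : ℝ :=
  max 1 (edgeLength p e) ^ (-α)

theorem rate_pos (e : Sym2 (Torus d m)) : 0 < rate p α e := by unfold rate; positivity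

theorem rate_le_one (hα0 : 0 ≤ α) (e : Sym2 (Torus d m)) : rate p α e ≤ 1 :=
  Real.rpow_le_one_of_one_le_of_nonpos (le_max_left _ _) (by linarith)

theorem rate_mk [NeZero m] (hp : 1 ≤ p) {x y : Torus d m} (hxy : x ≠ y) :
    rate p α s(x, y) = torusNorm p (x - y) ^ (-α) := by
  unfold rate
  rw [max_eq_right]
  · rfl
  · exact one_le_torusNorm hp (sub_ne_zero.mpr hxy)

theorem le_rate [NeZero m] (hp : 1 ≤ p) (hα0 : 0 ≤ α) (hd : 0 < d) (e : Sym2 (Torus d m)) :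
    ((d : ℝ) * m) ^ (-α) ≤ rate p α e := by
  refine Real.rpow_le_rpow_of_nonpos (by positivity) (max_le ?_ ?_) (by linarith)
  · exact_mod_cast Nat.mul_pos hd (NeZero.pos m)
  · induction e with
    | _ x y => exact torusNorm_le hp (x - y)

theorem sum_rate_erase [NeZero m] (hp : 1 ≤ p) (x : Torus d m) :
    ∑ y ∈ Finset.univ.erase x, rate p α s(x, y) = R d m p α := by
  rw [Finset.sum_congr rfl fun y hy => rate_mk hp (Finset.ne_of_mem_erase hy).symm]
  refine Finset.sum_equiv (Equiv.subLeft x) (fun y => ?_) (fun y _ => rfl)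
  simp only [Finset.mem_erase, Finset.mem_univ, and_true, Equiv.subLeft_apply]
  rw [not_iff_not, sub_eq_zero, eq_comm]

theorem sum_boundary_singleton [NeZero m] (hp : 1 ≤ p) (x : Torus d m) :
    ∑ e ∈ boundary {x}, rate p α e = R d m p α := by
  rw [sum_boundary, Finset.sum_singleton, ← sum_rate_erase hp x]
  congr 1
  ext; simp

theorem sum_boundary_le [NeZero m] (hp : 1 ≤ p) (A : Finset (Torus d m)) :
    ∑ e ∈ boundary A, rate p α e ≤ A.card * R d m p α := by
  rw [sum_boundary, ← nsmul_eq_mul]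
  refine Finset.sum_le_card_nsmul _ _ _ fun x hx => ?_
  rw [← sum_rate_erase hp x]
  refine Finset.sum_le_sum_of_subset_of_nonneg (fun y hy => ?_) fun _ _ _ => (rate_pos _).le
  refine Finset.mem_erase.mpr ⟨fun h => ?_, Finset.mem_univ y⟩
  exact Finset.mem_compl.mp hy (h ▸ hx)

/-- Each vertex of A has total rate R, of which at most ηR stays inside A. -/
theorem le_sum_boundary [NeZero m] (hp : 1 ≤ p) {η : ℝ} {A : Finset (Torus d m)}
    (hA : ∀ x, ∑ y ∈ A.erase x, rate p α s(x, y) ≤ η * R d m p α) :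
    (1 - η) * R d m p α * A.card ≤ ∑ e ∈ boundary A, rate p α e := by
  rw [sum_boundary, mul_comm, ← nsmul_eq_mul]
  refine Finset.card_nsmul_le_sum _ _ _ fun x hx => ?_
  have h1 : Finset.univ.erase x = Aᶜ ∪ A.erase x := by
    ext y
    simp only [Finset.mem_erase, Finset.mem_univ, and_true, Finset.mem_union, Finset.mem_compl]
    by_cases h : y = x
    · subst h; simp [hx]
    · simp [h]; tauto
  have h2 : Disjoint Aᶜ (A.erase x) :=
    Finset.disjoint_of_subset_right (Finset.erase_subset _ _) disjoint_compl_left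
  have h3 := sum_rate_erase (α := α) hp x
  rw [h1, Finset.sum_union h2] at h3
  linarith [hA x]

theorem card_torus (d m : ℕ) [NeZero m] : Fintype.card (Torus d m) = m ^ d := by
  rw [Fintype.card_fun, ZMod.card, Fintype.card_fin]

theorem R_le [NeZero m] (hp : 1 ≤ p) (hd : 0 < d) (hα0 : 0 ≤ α) (hαd : α < d) :
    R d m p α ≤ ((4 / (1 - α / d)) ^ d + 1) * (m : ℝ) ^ ((d : ℝ) - α) := by
  have hm : (0 : ℝ) < m := by exact_mod_cast NeZero.pos m
  have h := sum_torusNorm_sub_le hp hd hα0 hαd (Finset.univ : Finset (Torus d m)) 0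
    (k := m) (NeZero.pos m)
  simp only [zero_sub, torusNorm_neg] at h
  refine h.trans (le_of_eq ?_)
  rw [Finset.card_univ, card_torus, sub_eq_add_neg (d : ℝ), Real.rpow_add hm, Real.rpow_natCast]
  push_cast
  ring

/-- At least half of the m^d points are nonzero, and each lies at distance at most dm. -/
theorem le_R [NeZero m] (hm2 : 2 ≤ m) (hp : 1 ≤ p) (hd : 0 < d) (hα0 : 0 ≤ α) :
    (d : ℝ) ^ (-α) / 2 * (m : ℝ) ^ ((d : ℝ) - α) ≤ R d m p α := by
  have hm : (0 : ℝ) < m := by exact_mod_cast NeZero.pos m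
  have hcard : (m : ℝ) ^ d / 2 ≤ ((Finset.univ.erase (0 : Torus d m)).card : ℝ) := by
    rw [Finset.card_erase_of_mem (Finset.mem_univ _), Finset.card_univ, card_torus,
      Nat.cast_sub (Nat.one_le_pow _ _ (NeZero.pos m))]
    have : (2 : ℝ) ≤ (m : ℝ) ^ d := by
      have : 2 ≤ m ^ d := hm2.trans (Nat.le_self_pow hd.ne' m)
      exact_mod_cast this
    push_cast
    linarith
  have h := Finset.card_nsmul_le_sum (Finset.univ.erase (0 : Torus d m))
    (fun y => rate p α s(0, y)) _ fun y _ => le_rate hp hα0 hd s(0, y)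
  rw [sum_rate_erase hp, nsmul_eq_mul] at h
  refine le_trans (le_of_eq ?_) ((mul_le_mul_of_nonneg_right hcard (by positivity)).trans h)
  rw [Real.mul_rpow (Nat.cast_nonneg d) hm.le, sub_eq_add_neg, Real.rpow_add hm,
    Real.rpow_natCast]
  ring

/-- Small sets carry a small proportion of the total rate at a vertex. -/
theorem exists_sum_rate_le (hp : 1 ≤ p) (hd : 0 < d) (hα0 : 0 ≤ α) (hαd : α < d)
    {η : ℝ} (hη : 0 < η) : ∃ κ > 0, ∃ m₀ : ℕ, ∀ m [NeZero m], m₀ ≤ m →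
      ∀ A : Finset (Torus d m), (A.card : ℝ) ≤ κ * (m : ℝ) ^ d → ∀ x,
        ∑ y ∈ A.erase x, rate p α s(x, y) ≤ η * R d m p α := by
  have hd' : (0 : ℝ) < d := by exact_mod_cast hd
  have hγ : 0 < (d : ℝ) - α := by linarith
  have hβ : α / d < 1 := (div_lt_one hd').mpr hαd
  set C := (4 / (1 - α / d)) ^ d with hC
  have hC0 : 0 < C := pow_pos (div_pos (by norm_num) (by linarith)) d
  set c := (d : ℝ) ^ (-α) / 2 with hc
  have hc0 : 0 < c := by positivity
  -- The radius is k = ⌊εm⌋, with ε making the near part at most half of η c m^(d-α) ≤ ηR. Then κ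
  -- makes the far part |A| k^(-α) at most the other half, and m₀ ensures εm ≥ 1, hence k ≥ εm/2.
  set ε := (η * c / (2 * C)) ^ ((d : ℝ) - α)⁻¹ with hε
  have hε0 : 0 < ε := by positivity
  have hεC : C * ε ^ ((d : ℝ) - α) = η * c / 2 := by
    rw [hε, ← Real.rpow_mul (by positivity), inv_mul_cancel₀ hγ.ne', Real.rpow_one]
    field_simp
  refine ⟨η * c / 2 * (ε / 2) ^ α, by positivity, max 2 ⌈1 / ε⌉₊, fun m _ hm A hA x => ?_⟩
  have hm2 : 2 ≤ m := (le_max_left _ _).trans hm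
  have hm0 : (0 : ℝ) < m := by exact_mod_cast NeZero.pos m
  have hεm : 1 ≤ ε * m := by
    have : 1 / ε ≤ m := (Nat.le_ceil _).trans (by exact_mod_cast (le_max_right _ _).trans hm)
    rwa [div_le_iff₀' hε0] at this
  set k := ⌊ε * m⌋₊ with hk
  have hk1 : 1 ≤ k := Nat.le_floor (by simpa using hεm)
  have hk1' : (1 : ℝ) ≤ k := by exact_mod_cast hk1
  have hkle : (k : ℝ) ≤ ε * m := Nat.floor_le (by positivity)
  have hkge : ε / 2 * m ≤ k := by
    have := Nat.lt_floor_add_one (ε * m)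
    linarith
  rw [Finset.sum_congr rfl fun y hy => rate_mk hp (Finset.ne_of_mem_erase hy).symm]
  refine (sum_torusNorm_sub_le hp hd hα0 hαd A x hk1).trans ?_
  have h1 : C * (k : ℝ) ^ ((d : ℝ) - α) ≤ η * c / 2 * (m : ℝ) ^ ((d : ℝ) - α) := by
    rw [← hεC, mul_assoc, ← Real.mul_rpow hε0.le hm0.le]
    exact mul_le_mul_of_nonneg_left (Real.rpow_le_rpow (by positivity) hkle hγ.le) hC0.le
  have h2 : (A.card : ℝ) * (k : ℝ) ^ (-α) ≤ η * c / 2 * (m : ℝ) ^ ((d : ℝ) - α) := by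
    calc (A.card : ℝ) * (k : ℝ) ^ (-α)
        ≤ (η * c / 2 * (ε / 2) ^ α * (m : ℝ) ^ d) * (ε / 2 * m) ^ (-α) :=
          mul_le_mul hA (Real.rpow_le_rpow_of_nonpos (by positivity) hkge (by linarith))
            (by positivity) (by positivity)
      _ = _ := by
          rw [Real.mul_rpow (by positivity) hm0.le, sub_eq_add_neg, Real.rpow_add hm0,
            Real.rpow_natCast, Real.rpow_neg (by positivity) α]
          field_simp
  have h3 := mul_le_mul_of_nonneg_left (le_R (p := p) (α := α) hm2 hp hd hα0) hη.le
  rw [← hc] at h3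
  linarith

end Rates

/-! ### From the given weights to the product law `expLaw`. -/

section Transfer

variable {d m : ℕ} [NeZero m] {p : ℝ≥0∞} {α : ℝ} {Ω : Type*} [MeasurableSpace Ω] {P : Measure Ω}

/-- Extend edge weights by zero on the diagonal. -/
noncomputable def extendEdges (x : (graph d m).edgeSet → ℝ) (e : Sym2 (Torus d m)) : ℝ :=
  open Classical in if h : e ∈ (graph d m).edgeSet then x ⟨e, h⟩ else 0

theorem extendEdges_of_mem (x : (graph d m).edgeSet → ℝ) {e : Sym2 (Torus d m)}
    (he : e ∈ (graph d m).edgeSet) : extendEdges x e = x ⟨e, he⟩ := dif_pos he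

theorem measurable_extendEdges :
    Measurable (extendEdges : ((graph d m).edgeSet → ℝ) → Sym2 (Torus d m) → ℝ) := by
  refine measurable_pi_lambda _ fun e => ?_
  unfold extendEdges
  by_cases h : e ∈ (graph d m).edgeSet <;> simp only [h, dif_pos, dif_neg, not_false_eq_true] <;>
    fun_prop

theorem one_le_edgeLength (hp : 1 ≤ p) {e : Sym2 (Torus d m)} (he : e ∈ (graph d m).edgeSet) :
    1 ≤ edgeLength p e := by
  induction e with
  | _ x y =>
    have hxy : x ≠ y := he
    exact one_le_torusNorm hp (sub_ne_zero.mpr hxy)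

theorem rate_eq_inv (hp : 1 ≤ p) {e : Sym2 (Torus d m)} (he : e ∈ (graph d m).edgeSet) :
    rate p α e = (edgeLength p e ^ α)⁻¹ := by
  have h := one_le_edgeLength hp he
  rw [rate, max_eq_right h, Real.rpow_neg (by linarith)]

theorem measurable_edgeWeight : Measurable (edgeWeight p α : (Sym2 (Torus d m) → ℝ) → _) := by
  refine measurable_pi_lambda _ fun e => ?_
  unfold edgeWeight
  fun_prop

/-- `hinv` says that S ignores the diagonal, where nothing is known about E, so membership depends
only on the genuine edges. -/
theorem edgeWeight_mem_iff {S : Set (Sym2 (Torus d m) → ℝ)}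
    (hinv : ∀ W W', (∀ e ∈ (graph d m).edgeSet, W e = W' e) → W ∈ S → W' ∈ S)
    (E : Sym2 (Torus d m) → ℝ) :
    edgeWeight p α E ∈ S ↔ (fun e : (graph d m).edgeSet => E e) ∈
      (fun x => edgeWeight p α (extendEdges x)) ⁻¹' S := by
  refine ⟨hinv _ _ fun e he => ?_, hinv _ _ fun e he => ?_⟩ <;>
    simp only [edgeWeight, extendEdges_of_mem _ he]

/-- The edge weights have the joint law of independent exponential variables. -/
theorem measureReal_edgeWeight_mem [IsProbabilityMeasure P] (hp : 1 ≤ p)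
    {E : Sym2 (Torus d m) → Ω → ℝ}
    (hind : iIndepFun (fun e : (graph d m).edgeSet => E e) P)
    (hlaw : ∀ e ∈ (graph d m).edgeSet, HasLaw (E e) (expMeasure 1) P)
    {S : Set (Sym2 (Torus d m) → ℝ)} (hS : MeasurableSet S)
    (hinv : ∀ W W', (∀ e ∈ (graph d m).edgeSet, W e = W' e) → W ∈ S → W' ∈ S) :
    P.real {ω | edgeWeight p α (fun e => E e ω) ∈ S} = (expLaw (rate p α)).real S := by
  classical
  have hexp := isProbabilityMeasure_expMeasure one_pos
  have hrate := fun e : Sym2 (Torus d m) => isProbabilityMeasure_expMeasure (rate_pos (p := p)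
    (α := α) e)
  have hae : ∀ e : (graph d m).edgeSet, AEMeasurable (E e) P := fun e => (hlaw e e.2).aemeasurable
  have hmap := (iIndepFun_iff_map_fun_eq_pi_map hae).mp hind
  simp only [fun e : (graph d m).edgeSet => (hlaw e e.2).map_eq] at hmap
  have hW : Measurable fun x : (graph d m).edgeSet → ℝ => edgeWeight p α (extendEdges x) :=
    measurable_edgeWeight.comp measurable_extendEdges
  have hset : {ω | edgeWeight p α (fun e => E e ω) ∈ S} =
      (fun ω (e : (graph d m).edgeSet) => E e ω) ⁻¹'
        ((fun x => edgeWeight p α (extendEdges x)) ⁻¹' S) := by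
    ext ω
    exact edgeWeight_mem_iff hinv _
  have hscale : (Measure.pi fun _ : (graph d m).edgeSet => expMeasure 1).map
      (fun x e => edgeLength p e.1 ^ α * x e) =
        Measure.pi fun e : (graph d m).edgeSet => expMeasure (rate p α e.1) := by
    rw [Measure.pi_map_pi (hμ := fun e => by
      have : IsProbabilityMeasure ((expMeasure 1).map fun x => edgeLength p e.1 ^ α * x) :=
        Measure.isProbabilityMeasure_map (by fun_prop)
      infer_instance) (fun e => by fun_prop)]
    congr 1
    ext1 e
    have hpos : 0 < edgeLength p e.1 ^ α :=
      Real.rpow_pos_of_pos (zero_lt_one.trans_le (one_le_edgeLength hp e.2)) _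
    rw [expMeasure_map_const_mul hpos, rate_eq_inv hp e.2]
  have hrestr : MeasurePreserving
      (fun (T : Sym2 (Torus d m) → ℝ) (e : (graph d m).edgeSet) => T e) (expLaw (rate p α))
      (Measure.pi fun e : (graph d m).edgeSet => expMeasure (rate p α e.1)) :=
    -- Forgetting the diagonal coordinates of a product law leaves the product over the genuine
    -- edges.
    measurePreserving_fst.comp (measurePreserving_piEquivPiSubtypeProd
      (fun e : Sym2 (Torus d m) => expMeasure (rate p α e)) (· ∈ (graph d m).edgeSet))
  have hS' := measurable_extendEdges (d := d) (m := m) hS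
  have h1 : (expLaw (rate p α)) S = (Measure.pi fun e : (graph d m).edgeSet =>
      expMeasure (rate p α e.1)) (extendEdges ⁻¹' S) := by
    rw [← hrestr.measure_preimage hS'.nullMeasurableSet]
    congr 1
    ext T
    refine ⟨hinv _ _ fun e he => ?_, hinv _ _ fun e he => ?_⟩ <;> rw [extendEdges_of_mem _ he]
  rw [measureReal_def, measureReal_def, h1, hset,
    ← Measure.map_apply_of_aemeasurable (aemeasurable_pi_lambda _ hae) (hW hS), hmap, ← hscale,
    Measure.map_apply (by fun_prop) hS']
  congr 2
  ext x
  refine ⟨hinv _ _ fun e he => ?_, hinv _ _ fun e he => ?_⟩ <;>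
    simp only [edgeWeight, extendEdges_of_mem _ he]

theorem measureReal_inter_edgeWeight_mem [IsProbabilityMeasure P]
    {E : Sym2 (Torus d m) → Ω → ℝ} {β : Type*} [MeasurableSpace β] {Z : Ω → β}
    (hZ : IndepFun Z (fun ω (e : (graph d m).edgeSet) => E e ω) P) {B : Set β}
    (hB : MeasurableSet B) {S : Set (Sym2 (Torus d m) → ℝ)} (hS : MeasurableSet S)
    (hinv : ∀ W W', (∀ e ∈ (graph d m).edgeSet, W e = W' e) → W ∈ S → W' ∈ S) :
    P.real (Z ⁻¹' B ∩ {ω | edgeWeight p α (fun e => E e ω) ∈ S}) =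
      P.real (Z ⁻¹' B) * P.real {ω | edgeWeight p α (fun e => E e ω) ∈ S} := by
  have hW : Measurable fun x : (graph d m).edgeSet → ℝ => edgeWeight p α (extendEdges x) :=
    measurable_edgeWeight.comp measurable_extendEdges
  have hset : {ω | edgeWeight p α (fun e => E e ω) ∈ S} =
      (fun ω (e : (graph d m).edgeSet) => E e ω) ⁻¹'
        ((fun x => edgeWeight p α (extendEdges x)) ⁻¹' S) := by
    ext ω
    exact edgeWeight_mem_iff hinv _
  rw [hset, measureReal_def, hZ.measure_inter_preimage_eq_mul _ _ hB (hW hS), ENNReal.toReal_mul]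
  rfl

end Transfer

/-! ### Uniform upper tails on the torus. -/

section UpperTail

variable {d : ℕ} {p : ℝ≥0∞} {α : ℝ}

theorem R_pos {m : ℕ} [NeZero m] (hm2 : 2 ≤ m) (hp : 1 ≤ p) (hd : 0 < d) (hα0 : 0 ≤ α) :
    0 < R d m p α := by
  have hm0 : (0 : ℝ) < m := by exact_mod_cast NeZero.pos m
  have hd' : (0 : ℝ) < d := by exact_mod_cast hd
  exact lt_of_lt_of_le (by positivity) (le_R hm2 hp hd hα0)

theorem log_card_pos {m : ℕ} (hm2 : 2 ≤ m) (hd : 0 < d) : 0 < Real.log ((m : ℝ) ^ d) :=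
  Real.log_pos (one_lt_pow₀ (by exact_mod_cast hm2) hd.ne')

/-- Uniform exponential moment bound for all transmission times. -/
theorem exists_lintegral_exp_fpp_le (hp : 1 ≤ p) (hd : 0 < d) (hα0 : 0 ≤ α) (hαd : α < d)
    {δ : ℝ} (hδ : 0 < δ) (hδ1 : δ < 1) : ∃ C > 0, ∃ m₀ : ℕ, ∀ m [NeZero m], m₀ ≤ m →
      ∀ u v : Torus d m, ∫⁻ T, ENNReal.ofReal (Real.exp
        ((1 - δ) * ((1 - δ) * R d m p α) * fpp T u v)) ∂expLaw (rate p α) ≤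
          ENNReal.ofReal (C * (m : ℝ) ^ d) := by
  have hd' : (0 : ℝ) < d := by exact_mod_cast hd
  have hβ : α / d < 1 := (div_lt_one hd').mpr hαd
  obtain ⟨κ, hκ, m₀, hκm⟩ := exists_sum_rate_le hp hd hα0 hαd hδ
  set C₁ := (4 / (1 - α / d)) ^ d + 1 with hC₁
  have hC₁0 : 0 < C₁ := add_pos (pow_pos (div_pos (by norm_num) (by linarith)) d) one_pos
  set c := (d : ℝ) ^ (-α) with hc
  have hc0 : 0 < c := by positivity
  -- Clusters have size k = ⌈K√n⌉. K is so large that two disjoint ones are joined at rate at least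
  -- k² c m^(-α) ≥ 2 C₁ m^(d-α) ≥ 2R, using that every edge has rate at least c m^(-α).
  set K := 1 + 2 * C₁ / c with hK
  have hK1 : 1 ≤ K := by rw [hK]; linarith [show 0 < 2 * C₁ / c by positivity]
  have hKc : 2 * C₁ ≤ c * K ^ 2 := by
    have h1 : 2 * C₁ / c ≤ K ^ 2 := by nlinarith [hK]
    rwa [div_le_iff₀' hc0] at h1
  refine ⟨2 * (2 * K / δ) ^ 2, by positivity, max (max 2 m₀) ⌈(K / κ) ^ 2⌉₊,
    fun m _ hm u v => ?_⟩
  have hm2 : 2 ≤ m := (le_max_left _ _).trans ((le_max_left _ _).trans hm)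
  have hm0 : (0 : ℝ) < m := by exact_mod_cast NeZero.pos m
  have hRpos := R_pos (p := p) hm2 hp hd hα0
  set q := Real.sqrt ((m : ℝ) ^ d) with hq
  have hq2 : q ^ 2 = (m : ℝ) ^ d := Real.sq_sqrt (by positivity)
  have hm1 : (1 : ℝ) ≤ m := by exact_mod_cast NeZero.pos m
  have hq1 : 1 ≤ q := Real.one_le_sqrt.mpr (one_le_pow₀ hm1)
  -- This makes K√n ≤ κn, so `exists_sum_rate_le` applies throughout the growth.
  have hqκ : K / κ ≤ q := by
    refine Real.le_sqrt_of_sq_le ?_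
    calc (K / κ) ^ 2 ≤ ⌈(K / κ) ^ 2⌉₊ := Nat.le_ceil _
      _ ≤ (m : ℝ) := by exact_mod_cast (le_max_right _ _).trans hm
      _ ≤ (m : ℝ) ^ d := le_self_pow₀ hm1 hd.ne'
  have hKq : 1 ≤ K * q := one_le_mul_of_one_le_of_one_le hK1 hq1
  set k := ⌈K * q⌉₊ with hk
  have hk1 : 1 ≤ k := Nat.one_le_ceil_iff.mpr (by linarith)
  have hkge : K * q ≤ k := Nat.le_ceil _
  have hkle : (k : ℝ) ≤ 2 * K * q := by
    have := Nat.ceil_lt_add_one (a := K * q) (by linarith)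
    linarith
  refine (lintegral_exp_fpp_le (fun e => rate_pos e) (mul_pos (by linarith) hRpos) hδ hδ1 hk1
    (fun A _ hA => ?_) (fun A B _ hA hB => ?_) u v).trans (ENNReal.ofReal_le_ofReal ?_)
  · refine le_sum_boundary hp (hκm m ((le_max_right _ _).trans ((le_max_left _ _).trans hm)) A ?_)
    have h1 : (A.card : ℝ) < K * q := Nat.lt_ceil.mp hA
    rw [div_le_iff₀ hκ] at hqκ
    nlinarith
  · have h1 : ∀ x ∈ A, (k : ℝ) * (c * (m : ℝ) ^ (-α)) ≤ ∑ y ∈ B, rate p α s(x, y) := by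
      intro x _
      rw [← hB, ← nsmul_eq_mul, hc, ← Real.mul_rpow hd'.le hm0.le]
      exact Finset.card_nsmul_le_sum _ _ _ fun y _ => le_rate hp hα0 hd _
    have h2 := Finset.card_nsmul_le_sum A _ _ h1
    rw [hA, nsmul_eq_mul] at h2
    refine le_trans ?_ h2
    have h3 : (K * q) ^ 2 ≤ (k : ℝ) ^ 2 := pow_le_pow_left₀ (by linarith) hkge 2
    have h4 := R_le (m := m) hp hd hα0 hαd
    rw [sub_eq_add_neg (d : ℝ), Real.rpow_add hm0, Real.rpow_natCast] at h4
    have hα' : 0 < (m : ℝ) ^ (-α) := by positivity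
    calc 2 * ((1 - δ) * R d m p α) ≤ 2 * (C₁ * ((m : ℝ) ^ d * (m : ℝ) ^ (-α))) := by
          have : (1 - δ) * R d m p α ≤ R d m p α := by nlinarith
          linarith
      _ = (2 * C₁) * ((m : ℝ) ^ d * (m : ℝ) ^ (-α)) := by ring
      _ ≤ (c * K ^ 2) * ((m : ℝ) ^ d * (m : ℝ) ^ (-α)) :=
          mul_le_mul_of_nonneg_right hKc (by positivity)
      _ = (K * q) ^ 2 * (c * (m : ℝ) ^ (-α)) := by rw [mul_pow, hq2]; ring
      _ ≤ (k : ℝ) ^ 2 * (c * (m : ℝ) ^ (-α)) := mul_le_mul_of_nonneg_right h3 (by positivity)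
      _ = _ := by ring
  · rw [← hq2]
    have h1 : (k : ℝ) / δ ≤ 2 * K / δ * q := by
      rw [div_mul_eq_mul_div]
      exact div_le_div_of_nonneg_right hkle hδ.le
    calc 2 * ((k : ℝ) / δ) ^ 2 ≤ 2 * (2 * K / δ * q) ^ 2 :=
          mul_le_mul_of_nonneg_left (pow_le_pow_left₀ (by positivity) h1 2) (by norm_num)
      _ = _ := by ring

/-- Uniform upper tail bound for all transmission times. -/
theorem exists_upper_tail_le (hp : 1 ≤ p) (hd : 0 < d) (hα0 : 0 ≤ α) (hαd : α < d)
    {a ε : ℝ} (ha : 0 < a) (hε : 0 < ε) : ∃ C > 0, ∃ m₀ : ℕ, ∀ m [NeZero m], m₀ ≤ m →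
      ∀ u v : Torus d m, (expLaw (rate p α)).real {T | a + ε ≤ fpp T u v * scaling d m p α} ≤
        C * ((m : ℝ) ^ d) ^ (1 - a - ε / 2) := by
  -- Chosen so that (1 - δ)² (a + ε) ≥ (1 - 2δ)(a + ε) = a + ε/2: the two losses of 1 - δ use only
  -- half of ε.
  set δ := ε / (4 * (a + ε)) with hδ
  have hδ0 : 0 < δ := by positivity
  have hδa : 4 * δ * (a + ε) = ε := by rw [hδ]; field_simp
  have hδ1 : δ < 1 := by
    rw [hδ, div_lt_one (by positivity)]
    linarith
  obtain ⟨C, hC, m₀, h⟩ := exists_lintegral_exp_fpp_le hp hd hα0 hαd hδ0 hδ1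
  refine ⟨C, hC, max 2 m₀, fun m _ hm u v => ?_⟩
  have hm2 : 2 ≤ m := (le_max_left _ _).trans hm
  have hm0 : (0 : ℝ) < m := by exact_mod_cast NeZero.pos m
  have hRpos := R_pos (p := p) hm2 hp hd hα0
  have hL := log_card_pos hm2 hd
  have hn : (0 : ℝ) < (m : ℝ) ^ d := by positivity
  have key := h m ((le_max_right _ _).trans hm) u v
  set L := Real.log ((m : ℝ) ^ d)
  set ν := expLaw (rate p α : Sym2 (Torus d m) → ℝ)
  set b := Real.exp (-((1 - δ) ^ 2 * (a + ε) * L)) with hb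
  have hms : MeasurableSet {T : Sym2 (Torus d m) → ℝ | a + ε ≤ fpp T u v * scaling d m p α} :=
    measurableSet_le measurable_const ((measurable_fpp u v).mul_const _)
  have h1 : ν {T | a + ε ≤ fpp T u v * scaling d m p α} ≤
      ENNReal.ofReal (b * (C * (m : ℝ) ^ d)) := by
    rw [ENNReal.ofReal_mul (Real.exp_nonneg _)]
    refine le_trans ?_ (mul_le_mul' le_rfl key)
    rw [← lintegral_indicator_one hms, ← lintegral_const_mul' _ _ ENNReal.ofReal_ne_top]
    refine lintegral_mono fun T => ?_
    by_cases hT : a + ε ≤ fpp T u v * scaling d m p α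
    · rw [Set.indicator_of_mem (by exact hT), ← ENNReal.ofReal_mul (Real.exp_nonneg _),
        ← Real.exp_add, Pi.one_apply, ← ENNReal.ofReal_one]
      refine ENNReal.ofReal_le_ofReal (Real.one_le_exp ?_)
      have h2 : (a + ε) * L ≤ fpp T u v * R d m p α := by
        rw [scaling, ← mul_div_assoc, le_div_iff₀ hL] at hT
        exact hT
      nlinarith [sq_nonneg (1 - δ)]
    · rw [Set.indicator_of_notMem (by exact hT)]
      exact zero_le
  refine (ENNReal.toReal_le_of_le_ofReal (by positivity) h1).trans ?_
  rw [mul_left_comm]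
  refine mul_le_mul_of_nonneg_left ?_ hC.le
  have h3 : b ≤ ((m : ℝ) ^ d) ^ (-(a + ε / 2)) := by
    rw [hb, Real.rpow_def_of_pos hn]
    refine Real.exp_le_exp.mpr ?_
    have : a + ε / 2 ≤ (1 - δ) ^ 2 * (a + ε) := by nlinarith
    nlinarith
  calc b * (m : ℝ) ^ d ≤ ((m : ℝ) ^ d) ^ (-(a + ε / 2)) * (m : ℝ) ^ d :=
        mul_le_mul_of_nonneg_right h3 hn.le
    _ = ((m : ℝ) ^ d) ^ (1 - a - ε / 2) := by
        rw [show 1 - a - ε / 2 = -(a + ε / 2) + 1 by ring, Real.rpow_add hn, Real.rpow_one]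

end UpperTail

open Topology

/-! ### Convergence in probability from tails, and elementary limits. -/

section Asymptotics

theorem tendstoInMeasure_const_of_tails {Ω ι : Type*} [MeasurableSpace Ω] {P : Measure Ω}
    [IsProbabilityMeasure P] {l : Filter ι} {f : ι → Ω → ℝ} {a : ℝ} (ha : 0 < a)
    (hlow : ∀ ε, 0 < ε → ε < 1 →
      Tendsto (fun i => P.real {ω | f i ω ≤ a * (1 - ε)}) l (𝓝 0))
    (hup : ∀ ε, 0 < ε → Tendsto (fun i => P.real {ω | a + ε ≤ f i ω}) l (𝓝 0)) :
    TendstoInMeasure P f l (fun _ => a) := by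
  rw [tendstoInMeasure_iff_measureReal_dist]
  intro ε hε
  set δ := min (ε / a) (1 / 2) with hδ
  have hδ0 : 0 < δ := by positivity
  have hδ1 : δ < 1 := (min_le_right _ _).trans_lt (by norm_num)
  have hδa : a * δ ≤ ε := by
    have := mul_le_mul_of_nonneg_left (min_le_left (ε / a) (1 / 2)) ha.le
    rwa [mul_div_cancel₀ _ ha.ne'] at this
  have hsum := (hlow δ hδ0 hδ1).add (hup ε hε)
  rw [add_zero] at hsum
  refine squeeze_zero (fun _ => measureReal_nonneg) (fun i => ?_) hsum
  refine (measureReal_mono fun ω hω => ?_).trans (measureReal_union_le _ _)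
  have h : ε ≤ |f i ω - a| := hω
  rcases le_abs.mp h with h | h
  · exact Or.inr (show a + ε ≤ f i ω by linarith)
  · exact Or.inl (show f i ω ≤ a * (1 - δ) by linarith)

variable {d : ℕ} {p : ℝ≥0∞} {α : ℝ}

theorem tendsto_card_atTop (hd : 0 < d) :
    Tendsto (fun m : ℕ+ => ((m : ℕ) : ℝ) ^ d) atTop atTop :=
  (tendsto_pow_atTop hd.ne').comp
    (tendsto_natCast_atTop_atTop.comp tendsto_PNat_val_atTop_atTop)

theorem eventually_le_pnat (m₀ : ℕ) : ∀ᶠ m : ℕ+ in atTop, m₀ ≤ (m : ℕ) :=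
  tendsto_PNat_val_atTop_atTop.eventually_ge_atTop m₀

/-- R is at least of order m^(d-α), which beats the logarithm. This sends the isolation time s to 0
and so decorrelates isolated vertices. -/
theorem tendsto_log_div_R (hp : 1 ≤ p) (hd : 0 < d) (hα0 : 0 ≤ α) (hαd : α < d) :
    Tendsto (fun m : ℕ+ => Real.log (((m : ℕ) : ℝ) ^ d) / R d m p α) atTop (𝓝 0) := by
  have hγ : 0 < (d : ℝ) - α := by linarith
  set c := (d : ℝ) ^ (-α) / 2 with hc
  have hd' : (0 : ℝ) < d := by exact_mod_cast hd
  have hc0 : 0 < c := by positivity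
  have h1 : Tendsto (fun m : ℕ+ => (d / c : ℝ) *
      (Real.log ((m : ℕ) : ℝ) / ((m : ℕ) : ℝ) ^ ((d : ℝ) - α))) atTop (𝓝 0) := by
    have := ((isLittleO_log_rpow_atTop hγ).tendsto_div_nhds_zero.comp
      (tendsto_natCast_atTop_atTop.comp tendsto_PNat_val_atTop_atTop)).const_mul (d / c : ℝ)
    simpa using this
  refine squeeze_zero' ?_ ?_ h1
  · filter_upwards [eventually_le_pnat 2] with m hm
    exact div_nonneg (log_card_pos hm hd).le (R_pos hm hp hd hα0).le
  · filter_upwards [eventually_le_pnat 2] with m hm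
    have hm0 : (0 : ℝ) < (m : ℕ) := by exact_mod_cast m.pos
    have hm1 : (1 : ℝ) ≤ (m : ℕ) := by exact_mod_cast m.pos
    have hR := le_R (p := p) (α := α) hm hp hd hα0
    rw [← hc] at hR
    have hpos : 0 < c * ((m : ℕ) : ℝ) ^ ((d : ℝ) - α) := by positivity
    calc Real.log (((m : ℕ) : ℝ) ^ d) / R d m p α
        ≤ Real.log (((m : ℕ) : ℝ) ^ d) / (c * ((m : ℕ) : ℝ) ^ ((d : ℝ) - α)) :=
          div_le_div_of_nonneg_left (log_card_pos hm hd).le hpos hR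
      _ = _ := by rw [Real.log_pow]; field_simp

theorem tendsto_log_div_atTop : Tendsto (fun x : ℝ => Real.log x / x) atTop (𝓝 0) := by
  simpa using (isLittleO_log_rpow_atTop one_pos).tendsto_div_nhds_zero

end Asymptotics

/-! ### Lower tails at times (1 - ε) log n / R. -/

section LowerTails

variable {d m : ℕ} [NeZero m] {p : ℝ≥0∞} {α ε : ℝ}

theorem mul_scaling_le_iff (hm2 : 2 ≤ m) (hp : 1 ≤ p) (hd : 0 < d) (hα0 : 0 ≤ α) (x a : ℝ) :
    x * scaling d m p α ≤ a * (1 - ε) ↔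
      x ≤ a * ((1 - ε) * Real.log ((m : ℝ) ^ d) / R d m p α) := by
  rw [scaling, ← mul_div_assoc, div_le_iff₀ (log_card_pos hm2 hd), ← mul_div_assoc,
    le_div_iff₀ (R_pos hm2 hp hd hα0), mul_assoc a]

/-- With τ = 1 + ε the exponent is (1 + ε)(1 - ε) = 1 - ε², so the ball size is still o(n). -/
theorem exp_growth_eq (hm2 : 2 ≤ m) (hp : 1 ≤ p) (hd : 0 < d) (hα0 : 0 ≤ α) :
    Real.exp ((1 + ε) * R d m p α * ((1 - ε) * Real.log ((m : ℝ) ^ d) / R d m p α)) =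
      (m : ℝ) ^ d * ((m : ℝ) ^ d) ^ (-ε ^ 2) := by
  have hR := R_pos (p := p) hm2 hp hd hα0
  have hm0 : (0 : ℝ) < m := by exact_mod_cast NeZero.pos m
  have hn : (0 : ℝ) < (m : ℝ) ^ d := by positivity
  have h : (m : ℝ) ^ d * ((m : ℝ) ^ d) ^ (-ε ^ 2) = ((m : ℝ) ^ d) ^ (1 + -ε ^ 2) := by
    rw [Real.rpow_add hn, Real.rpow_one]
  rw [h, Real.rpow_def_of_pos hn]
  congr 1
  field_simp
  ring

/-- This is the mean number of isolated vertices, which tends to infinity. -/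
theorem card_mul_exp_eq (hm2 : 2 ≤ m) (hp : 1 ≤ p) (hd : 0 < d) (hα0 : 0 ≤ α) :
    Fintype.card (Torus d m) *
      Real.exp (-((1 - ε) * Real.log ((m : ℝ) ^ d) / R d m p α * R d m p α)) =
        ((m : ℝ) ^ d) ^ ε := by
  have hR := R_pos (p := p) hm2 hp hd hα0
  have hm0 : (0 : ℝ) < m := by exact_mod_cast NeZero.pos m
  have hn : (0 : ℝ) < (m : ℝ) ^ d := by positivity
  rw [card_torus, div_mul_cancel₀ _ hR.ne', Real.rpow_def_of_pos hn]
  push_cast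
  conv_lhs => rw [← Real.exp_log hn, ← Real.exp_add, Real.log_exp]
  congr 1
  ring

theorem typical_lower_tail (hm2 : 2 ≤ m) (hp : 1 ≤ p) (hd : 0 < d) (hα0 : 0 ≤ α)
    (hε0 : 0 < ε) (u : Torus d m) :
    ∑ v ∈ Finset.univ.erase u,
      (expLaw (rate p α)).real {T | fpp T u v * scaling d m p α ≤ 1 * (1 - ε)} ≤
        (m : ℝ) ^ d * ((m : ℝ) ^ d) ^ (-ε ^ 2) / ε := by
  simp only [mul_scaling_le_iff hm2 hp hd hα0]
  simp only [one_mul]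
  have h := sum_measure_fpp_le (fun e => rate_pos e) (R_pos (p := p) hm2 hp hd hα0)
    (τ := 1 + ε) (by linarith) (fun A => sum_boundary_le hp A) u
    ((1 - ε) * Real.log ((m : ℝ) ^ d) / R d m p α)
  rwa [exp_growth_eq hm2 hp hd hα0, add_sub_cancel_left] at h

theorem flooding_lower_tail (hm2 : 2 ≤ m) (hp : 1 ≤ p) (hd : 0 < d) (hα0 : 0 ≤ α)
    (hε0 : 0 < ε) (hε1 : ε < 1) (u : Torus d m) :
    (expLaw (rate p α)).real {T | ∀ v, fpp T u v * scaling d m p α ≤ 2 * (1 - ε)} ≤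
      4 * (((m : ℝ) ^ d) ^ (-ε) +
        Real.exp ((1 - ε) * (Real.log ((m : ℝ) ^ d) / R d m p α)) - 1) +
      2 * (((m : ℝ) ^ d)⁻¹ + ((m : ℝ) ^ d) ^ (-ε ^ 2) / ε) := by
  have hR := R_pos (p := p) hm2 hp hd hα0
  have hm0 : (0 : ℝ) < m := by exact_mod_cast NeZero.pos m
  have hn : (0 : ℝ) < (m : ℝ) ^ d := by positivity
  have hs : 0 ≤ (1 - ε) * Real.log ((m : ℝ) ^ d) / R d m p α :=
    div_nonneg (mul_nonneg (by linarith) (log_card_pos hm2 hd).le) hR.le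
  simp only [mul_scaling_le_iff hm2 hp hd hα0]
  have h := flooding_lower_bound (fun e => rate_pos e) (fun _ _ _ => rate_le_one hα0 _) hR
    (fun v => sum_boundary_singleton hp v) (fun A => sum_boundary_le hp A)
    (τ := 1 + ε) (by linarith) hs (t := (1 - ε) * Real.log ((m : ℝ) ^ d) / R d m p α) u rfl
  rw [exp_growth_eq hm2 hp hd hα0, card_mul_exp_eq hm2 hp hd hα0, ← Real.rpow_neg hn.le,
    add_sub_cancel_left, card_torus] at h
  simp only [← two_mul] at h
  refine h.trans (le_of_eq ?_)
  push_cast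
  rw [← mul_div_assoc]
  field_simp

theorem diameter_lower_tail (hm2 : 2 ≤ m) (hp : 1 ≤ p) (hd : 0 < d) (hα0 : 0 ≤ α)
    (hε0 : 0 < ε) (hε1 : ε < 1) :
    (expLaw (rate p α)).real {T : Sym2 (Torus d m) → ℝ |
        ∀ v w, fpp T v w * scaling d m p α ≤ 3 * (1 - ε)} ≤
      4 * (((m : ℝ) ^ d) ^ (-ε) +
        Real.exp ((1 - ε) * (Real.log ((m : ℝ) ^ d) / R d m p α)) - 1) +
      (4 * ((m : ℝ) ^ d) ^ (-ε) +
        4 * Real.exp ((1 - ε) * (Real.log ((m : ℝ) ^ d) / R d m p α)) *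
          (((m : ℝ) ^ d) ^ (-ε ^ 2) / ε +
            2 * (1 - ε) * (Real.log ((m : ℝ) ^ d) / (m : ℝ) ^ d))) := by
  have hR := R_pos (p := p) hm2 hp hd hα0
  have hm0 : (0 : ℝ) < m := by exact_mod_cast NeZero.pos m
  have hn : (0 : ℝ) < (m : ℝ) ^ d := by positivity
  have hs : 0 ≤ (1 - ε) * Real.log ((m : ℝ) ^ d) / R d m p α :=
    div_nonneg (mul_nonneg (by linarith) (log_card_pos hm2 hd).le) hR.le
  have h3 : ∀ x : ℝ, 2 * x + x = 3 * x := fun x => by ring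
  simp only [mul_scaling_le_iff hm2 hp hd hα0]
  have h := diameter_lower_bound (fun e => rate_pos e) (fun _ _ _ => rate_le_one hα0 _) hR
    (fun v => sum_boundary_singleton hp v) (fun A => sum_boundary_le hp A)
    (τ := 1 + ε) (by linarith) hs hs rfl
  rw [exp_growth_eq hm2 hp hd hα0, card_mul_exp_eq hm2 hp hd hα0, ← Real.rpow_neg hn.le,
    add_sub_cancel_left, card_torus] at h
  simp only [h3] at h
  refine h.trans (le_of_eq ?_)
  push_cast
  rw [← mul_div_assoc]
  field_simp
  ring

end LowerTails

/-! ### Averaging over a uniform pair. -/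

section UniformPair

variable {d m : ℕ} [NeZero m] {p : ℝ≥0∞} {α : ℝ} {Ω : Type*} [MeasurableSpace Ω] {P : Measure Ω}
  [IsProbabilityMeasure P]

/-- Averaging over a uniform pair of distinct vertices independent of the weights. -/
theorem measureReal_uniform_pair_le (hp : 1 ≤ p) {E : Sym2 (Torus d m) → Ω → ℝ}
    (hind : iIndepFun (fun e : (graph d m).edgeSet => E e) P)
    (hlaw : ∀ e ∈ (graph d m).edgeSet, HasLaw (E e) (expMeasure 1) P)
    {Z : Ω → Torus d m × Torus d m} (hZ : HasLaw Z (uniformOn {q | q.1 ≠ q.2}) P)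
    (hZE : IndepFun Z (fun ω (e : (graph d m).edgeSet) => E e ω) P)
    {S : Torus d m × Torus d m → Set (Sym2 (Torus d m) → ℝ)} (hS : ∀ q, MeasurableSet (S q))
    (hinv : ∀ q W W', (∀ e ∈ (graph d m).edgeSet, W e = W' e) → W ∈ S q → W' ∈ S q) :
    P.real {ω | edgeWeight p α (fun e => E e ω) ∈ S (Z ω)} ≤
      ((m : ℝ) ^ d * ((m : ℝ) ^ d - 1))⁻¹ *
        ∑ u, ∑ v ∈ Finset.univ.erase u, (expLaw (rate p α)).real (S (u, v)) := by
  have hsub : {ω | edgeWeight p α (fun e => E e ω) ∈ S (Z ω)} ⊆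
      ⋃ q, Z ⁻¹' {q} ∩ {ω | edgeWeight p α (fun e => E e ω) ∈ S q} := fun ω hω =>
    Set.mem_iUnion.mpr ⟨Z ω, rfl, hω⟩
  have hprob : ∀ q : Torus d m × Torus d m, P.real (Z ⁻¹' {q}) =
      if q.1 = q.2 then 0 else ((m : ℝ) ^ d * ((m : ℝ) ^ d - 1))⁻¹ := by
    intro q
    have hD : {q : Torus d m × Torus d m | q.1 ≠ q.2} =
        ((Finset.univ : Finset (Torus d m)).offDiag : Set _) := by
      ext q; simp
    have h1 : P (Z ⁻¹' {q}) = uniformOn {q : Torus d m × Torus d m | q.1 ≠ q.2} {q} := by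
      rw [← hZ.map_eq, Measure.map_apply_of_aemeasurable hZ.aemeasurable
        (measurableSet_singleton q)]
    rw [measureReal_def, h1, hD, ← Finset.coe_singleton, uniformOn_apply_finset,
      Finset.offDiag_card, Finset.card_univ, card_torus]
    have hcast : ((m ^ d * m ^ d - m ^ d : ℕ) : ℝ) = (m : ℝ) ^ d * ((m : ℝ) ^ d - 1) := by
      rw [Nat.cast_sub (Nat.le_mul_self _)]
      push_cast
      ring
    by_cases h : q.1 = q.2
    · rw [if_pos h, Finset.inter_singleton_of_notMem (by simp [h])]
      simp
    · rw [if_neg h, Finset.inter_singleton_of_mem (by simp [h]), ENNReal.toReal_div,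
        ENNReal.toReal_natCast, ENNReal.toReal_natCast, hcast]
      simp
  refine (measureReal_mono hsub).trans ((measureReal_iUnion_fintype_le _).trans ?_)
  rw [Fintype.sum_prod_type, Finset.mul_sum]
  refine Finset.sum_le_sum fun u _ => ?_
  rw [Finset.mul_sum, ← Finset.add_sum_erase _ _ (Finset.mem_univ u)]
  have hterm : ∀ v, P.real (Z ⁻¹' {(u, v)} ∩ {ω | edgeWeight p α (fun e => E e ω) ∈ S (u, v)}) =
      (if u = v then 0 else ((m : ℝ) ^ d * ((m : ℝ) ^ d - 1))⁻¹) *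
        (expLaw (rate p α)).real (S (u, v)) := fun v => by
    rw [measureReal_inter_edgeWeight_mem hZE (measurableSet_singleton _) (hS _) (hinv _),
      measureReal_edgeWeight_mem hp hind hlaw (hS _) (hinv _), hprob]
  simp only [hterm]
  rw [if_true, zero_mul, zero_add]
  refine Finset.sum_le_sum fun v hv => ?_
  rw [if_neg (Finset.ne_of_mem_erase hv).symm]

end UniformPair

/-! ### The three limits. -/

section Limits

open Topology

variable {d : ℕ} {p : ℝ≥0∞} {α : ℝ} {Ω : Type*} [MeasurableSpace Ω] {P : Measure Ω}
  [IsProbabilityMeasure P]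

theorem measurableSet_fpp_mul_le {V : Type*} [Fintype V] [DecidableEq V] (u v : V) (s a : ℝ) :
    MeasurableSet {T : Sym2 V → ℝ | fpp T u v * s ≤ a} :=
  measurableSet_le ((measurable_fpp u v).mul_const s) measurable_const

theorem measurableSet_le_fpp_mul {V : Type*} [Fintype V] [DecidableEq V] (u v : V) (s a : ℝ) :
    MeasurableSet {T : Sym2 V → ℝ | a ≤ fpp T u v * s} :=
  measurableSet_le measurable_const ((measurable_fpp u v).mul_const s)

theorem tendsto_card_rpow_neg (hd : 0 < d) {y : ℝ} (hy : 0 < y) :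
    Tendsto (fun m : ℕ+ => (((m : ℕ) : ℝ) ^ d) ^ (-y)) atTop (𝓝 0) :=
  (tendsto_rpow_neg_atTop hy).comp (tendsto_card_atTop hd)

theorem tendsto_exp_log_div_R (hp : 1 ≤ p) (hd : 0 < d) (hα0 : 0 ≤ α) (hαd : α < d) (c : ℝ) :
    Tendsto (fun m : ℕ+ => Real.exp (c * (Real.log (((m : ℕ) : ℝ) ^ d) / R d m p α)))
      atTop (𝓝 1) := by
  have h := (tendsto_log_div_R hp hd hα0 hαd).const_mul c
  rw [mul_zero] at h
  rw [← Real.exp_zero]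
  exact (Real.continuous_exp.tendsto 0).comp h

variable {E : (m : ℕ+) → Sym2 (Torus d m) → Ω → ℝ}

theorem tendsto_typical (hp : 1 ≤ p) (hd : 0 < d) (hα0 : 0 ≤ α) (hαd : α < d)
    (hind : ∀ m : ℕ+, iIndepFun (fun e : (graph d m).edgeSet => E m e) P)
    (hlaw : ∀ m : ℕ+, ∀ e ∈ (graph d m).edgeSet, HasLaw (E m e) (expMeasure 1) P)
    {U V : (m : ℕ+) → Ω → Torus d m}
    (hUV : ∀ m : ℕ+, 2 ≤ m → HasLaw (fun ω => (U m ω, V m ω)) (uniformOn {q | q.1 ≠ q.2}) P)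
    (hUVE : ∀ m : ℕ+, 2 ≤ m → IndepFun (fun ω => (U m ω, V m ω))
      (fun ω (e : (graph d m).edgeSet) => E m e ω) P) :
    TendstoInMeasure P (fun (m : ℕ+) ω =>
      fpp (edgeWeight p α fun e => E m e ω) (U m ω) (V m ω) * scaling d m p α)
      atTop (fun _ => 1) := by
  refine tendstoInMeasure_const_of_tails one_pos (fun ε hε0 hε1 => ?_) (fun ε hε => ?_)
  · have hlim : Tendsto (fun m : ℕ+ => 2 / ε * (((m : ℕ) : ℝ) ^ d) ^ (-ε ^ 2)) atTop (𝓝 0) := by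
      simpa using (tendsto_card_rpow_neg hd (by positivity : 0 < ε ^ 2)).const_mul (2 / ε)
    refine squeeze_zero' (Eventually.of_forall fun _ => measureReal_nonneg) ?_ hlim
    filter_upwards [eventually_le_pnat 2] with m hm
    have h := measureReal_uniform_pair_le (α := α) hp (hind m) (hlaw m) (hUV m hm) (hUVE m hm)
      (S := fun q => {T | fpp T q.1 q.2 * scaling d m p α ≤ 1 * (1 - ε)})
      (fun q => measurableSet_fpp_mul_le _ _ _ _)
      (fun q W W' hW h => by rwa [Set.mem_ofPred_eq, ← fpp_congr hW])
    have h2 := Finset.sum_le_sum fun u (_ : u ∈ (Finset.univ : Finset (Torus d m))) =>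
      typical_lower_tail hm hp hd hα0 hε0 u
    have hn : (2 : ℝ) ≤ ((m : ℕ) : ℝ) ^ d := by
      exact_mod_cast (show 2 ≤ (m : ℕ) from hm).trans (Nat.le_self_pow hd.ne' _)
    rw [Finset.sum_const, Finset.card_univ, card_torus, nsmul_eq_mul] at h2
    push_cast at h2
    refine h.trans ((mul_le_mul_of_nonneg_left h2
      (inv_nonneg.mpr (mul_nonneg (by linarith) (by linarith)))).trans ?_)
    set x := ((m : ℕ) : ℝ) ^ d
    -- The price of averaging over distinct pairs only.
    have hx : x / (x - 1) ≤ 2 := by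
      rw [div_le_iff₀ (by linarith)]; linarith
    have hx1 : x - 1 ≠ 0 := by linarith
    calc (x * (x - 1))⁻¹ * (x * (x * x ^ (-ε ^ 2) / ε)) = x / (x - 1) * (x ^ (-ε ^ 2) / ε) := by
          field_simp
      _ ≤ 2 * (x ^ (-ε ^ 2) / ε) := mul_le_mul_of_nonneg_right hx (by positivity)
      _ = _ := by ring
  · obtain ⟨C, hC, m₀, hC'⟩ := exists_upper_tail_le (d := d) hp hd hα0 hαd one_pos hε
    have hlim : Tendsto (fun m : ℕ+ => C * (((m : ℕ) : ℝ) ^ d) ^ (1 - 1 - ε / 2))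
        atTop (𝓝 0) := by
      simpa using (tendsto_card_rpow_neg hd (by positivity : 0 < ε / 2)).const_mul C
    refine squeeze_zero' (Eventually.of_forall fun _ => measureReal_nonneg) ?_ hlim
    filter_upwards [eventually_le_pnat 2, eventually_le_pnat m₀] with m hm hm₀
    have h := measureReal_uniform_pair_le (α := α) hp (hind m) (hlaw m) (hUV m hm) (hUVE m hm)
      (S := fun q => {T | 1 + ε ≤ fpp T q.1 q.2 * scaling d m p α})
      (fun q => measurableSet_le_fpp_mul _ _ _ _)
      (fun q W W' hW h => by rwa [Set.mem_ofPred_eq, ← fpp_congr hW])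
    have hn : (2 : ℝ) ≤ ((m : ℕ) : ℝ) ^ d := by
      exact_mod_cast (show 2 ≤ (m : ℕ) from hm).trans (Nat.le_self_pow hd.ne' _)
    have hcard : ∀ u : Torus d m, ((Finset.univ.erase u).card : ℝ) = ((m : ℕ) : ℝ) ^ d - 1 := by
      intro u
      rw [Finset.card_erase_of_mem (Finset.mem_univ u), Finset.card_univ, card_torus,
        Nat.cast_sub (Nat.one_le_pow _ _ m.pos)]
      push_cast
      rfl
    have h2 := Finset.sum_le_sum fun u (_ : u ∈ (Finset.univ : Finset (Torus d m))) =>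
      Finset.sum_le_card_nsmul (Finset.univ.erase u) _ _ fun v _ => hC' m hm₀ u v
    simp only [nsmul_eq_mul, hcard] at h2
    rw [Finset.sum_const, Finset.card_univ, card_torus, nsmul_eq_mul] at h2
    push_cast at h2
    refine h.trans ((mul_le_mul_of_nonneg_left h2
      (inv_nonneg.mpr (mul_nonneg (by linarith) (by linarith)))).trans (le_of_eq ?_))
    rw [← mul_assoc (((m : ℕ) : ℝ) ^ d), inv_mul_cancel_left₀]
    exact mul_ne_zero (by linarith) (by linarith)

theorem tendsto_flooding (hp : 1 ≤ p) (hd : 0 < d) (hα0 : 0 ≤ α) (hαd : α < d)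
    (hind : ∀ m : ℕ+, iIndepFun (fun e : (graph d m).edgeSet => E m e) P)
    (hlaw : ∀ m : ℕ+, ∀ e ∈ (graph d m).edgeSet, HasLaw (E m e) (expMeasure 1) P)
    (u : (m : ℕ+) → Torus d m) :
    TendstoInMeasure P (fun (m : ℕ+) ω =>
      floodingTime (edgeWeight p α fun e => E m e ω) (u m) * scaling d m p α)
      atTop (fun _ => 2) := by
  refine tendstoInMeasure_const_of_tails two_pos (fun ε hε0 hε1 => ?_) (fun ε hε => ?_)
  · have h1 := tendsto_card_rpow_neg hd hε0
    have h2 := tendsto_card_rpow_neg hd (by positivity : 0 < ε ^ 2)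
    have h3 := tendsto_exp_log_div_R hp hd hα0 hαd (1 - ε)
    have h4 := tendsto_inv_atTop_zero.comp (tendsto_card_atTop hd)
    have hlim := (((h1.add h3).sub_const 1).const_mul 4).add
      ((h4.add (h2.div_const ε)).const_mul 2)
    have h0 : (4 * (0 + 1 - 1) + 2 * (0 + 0 / ε) : ℝ) = 0 := by ring
    rw [h0] at hlim
    refine squeeze_zero' (Eventually.of_forall fun _ => measureReal_nonneg) ?_ hlim
    filter_upwards [eventually_le_pnat 2] with m hm
    refine le_trans ?_ (flooding_lower_tail hm hp hd hα0 hε0 hε1 (u m))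
    rw [← measureReal_edgeWeight_mem hp (hind m) (hlaw m)
      (S := {T | ∀ v, fpp T (u m) v * scaling d m p α ≤ 2 * (1 - ε)}) (by
      rw [Set.ofPred_forall]
      exact MeasurableSet.iInter fun v => measurableSet_fpp_mul_le _ _ _ _)
      (fun W W' hW h v => by rw [← fpp_congr hW]; exact h v)]
    refine measureReal_mono fun ω hω v => ?_
    refine le_trans (mul_le_mul_of_nonneg_right ?_ ?_) hω
    · exact Finset.le_sup' (fun v => transmissionTime (edgeWeight p α fun e => E m e ω) (u m) v)
        (Finset.mem_univ v)
    · exact (div_pos (R_pos hm hp hd hα0) (log_card_pos hm hd)).le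
  · obtain ⟨C, hC, m₀, hC'⟩ := exists_upper_tail_le (d := d) hp hd hα0 hαd two_pos hε
    have hlim : Tendsto (fun m : ℕ+ => C * (((m : ℕ) : ℝ) ^ d) ^ (-(ε / 2))) atTop (𝓝 0) := by
      simpa using (tendsto_card_rpow_neg hd (by positivity : 0 < ε / 2)).const_mul C
    refine squeeze_zero' (Eventually.of_forall fun _ => measureReal_nonneg) ?_ hlim
    filter_upwards [eventually_le_pnat m₀] with m hm₀
    have hn : (0 : ℝ) < ((m : ℕ) : ℝ) ^ d := pow_pos (by exact_mod_cast m.pos) d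
    -- Union bound over the n possible farthest vertices, each costing n^(-1 - ε/2) up to a
    -- constant.
    calc _ ≤ P.real (⋃ v, {ω | edgeWeight p α (fun e => E m e ω) ∈
          {T | 2 + ε ≤ fpp T (u m) v * scaling d m p α}}) := by
          refine measureReal_mono fun ω hω => ?_
          obtain ⟨v, -, hv⟩ := Finset.exists_mem_eq_sup' Finset.univ_nonempty
            (fun v => transmissionTime (edgeWeight p α fun e => E m e ω) (u m) v)
          refine Set.mem_iUnion.mpr ⟨v, ?_⟩
          have h : 2 + ε ≤ floodingTime (edgeWeight p α fun e => E m e ω) (u m) *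
            scaling d m p α := hω
          rw [floodingTime, hv] at h
          exact h
      _ ≤ ∑ v : Torus d m, C * (((m : ℕ) : ℝ) ^ d) ^ (1 - 2 - ε / 2) := by
          refine (measureReal_iUnion_fintype_le _).trans (Finset.sum_le_sum fun v _ => ?_)
          rw [measureReal_edgeWeight_mem hp (hind m) (hlaw m)
            (measurableSet_le_fpp_mul _ _ _ _)
            (fun W W' hW h => by rwa [Set.mem_ofPred_eq, ← fpp_congr hW])]
          exact hC' m hm₀ (u m) v
      _ = _ := by
          rw [Finset.sum_const, Finset.card_univ, card_torus, nsmul_eq_mul,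
            show -(ε / 2) = 1 + (1 - 2 - ε / 2) by ring, Real.rpow_add hn, Real.rpow_one]
          push_cast
          ring

theorem tendsto_diameter (hp : 1 ≤ p) (hd : 0 < d) (hα0 : 0 ≤ α) (hαd : α < d)
    (hind : ∀ m : ℕ+, iIndepFun (fun e : (graph d m).edgeSet => E m e) P)
    (hlaw : ∀ m : ℕ+, ∀ e ∈ (graph d m).edgeSet, HasLaw (E m e) (expMeasure 1) P) :
    TendstoInMeasure P (fun (m : ℕ+) ω =>
      diameter (edgeWeight p α fun e => E m e ω) * scaling d m p α)
      atTop (fun _ => 3) := by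
  refine tendstoInMeasure_const_of_tails three_pos (fun ε hε0 hε1 => ?_) (fun ε hε => ?_)
  · have h1 := tendsto_card_rpow_neg hd hε0
    have h2 := tendsto_card_rpow_neg hd (by positivity : 0 < ε ^ 2)
    have h3 := tendsto_exp_log_div_R hp hd hα0 hαd (1 - ε)
    have h4 := tendsto_log_div_atTop.comp (tendsto_card_atTop hd)
    have hlim := (((h1.add h3).sub_const 1).const_mul 4).add
      ((h1.const_mul 4).add ((h3.const_mul 4).mul
        ((h2.div_const ε).add (h4.const_mul (2 * (1 - ε))))))
    have h0 : (4 * (0 + 1 - 1) + (4 * 0 + 4 * 1 * (0 / ε + 2 * (1 - ε) * 0)) : ℝ) = 0 := by ring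
    rw [h0] at hlim
    refine squeeze_zero' (Eventually.of_forall fun _ => measureReal_nonneg) ?_ hlim
    filter_upwards [eventually_le_pnat 2] with m hm
    refine le_trans ?_ (diameter_lower_tail hm hp hd hα0 hε0 hε1)
    rw [← measureReal_edgeWeight_mem hp (hind m) (hlaw m)
      (S := {T | ∀ v w, fpp T v w * scaling d m p α ≤ 3 * (1 - ε)}) (by
      simp only [Set.ofPred_forall]
      exact MeasurableSet.iInter fun v => MeasurableSet.iInter fun w =>
        measurableSet_fpp_mul_le _ _ _ _)
      (fun W W' hW h v w => by rw [← fpp_congr hW]; exact h v w)]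
    refine measureReal_mono fun ω hω v w => ?_
    refine le_trans (mul_le_mul_of_nonneg_right ?_ ?_) hω
    · exact Finset.le_sup' (fun q : Torus d m × Torus d m =>
        transmissionTime (edgeWeight p α fun e => E m e ω) q.1 q.2) (Finset.mem_univ (v, w))
    · exact (div_pos (R_pos hm hp hd hα0) (log_card_pos hm hd)).le
  · obtain ⟨C, hC, m₀, hC'⟩ := exists_upper_tail_le (d := d) hp hd hα0 hαd three_pos hε
    have hlim : Tendsto (fun m : ℕ+ => C * (((m : ℕ) : ℝ) ^ d) ^ (-(ε / 2))) atTop (𝓝 0) := by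
      simpa using (tendsto_card_rpow_neg hd (by positivity : 0 < ε / 2)).const_mul C
    refine squeeze_zero' (Eventually.of_forall fun _ => measureReal_nonneg) ?_ hlim
    filter_upwards [eventually_le_pnat m₀] with m hm₀
    have hn : (0 : ℝ) < ((m : ℕ) : ℝ) ^ d := pow_pos (by exact_mod_cast m.pos) d
    -- Union bound over n² pairs, each costing n^(-2 - ε/2) up to a constant.
    calc _ ≤ P.real (⋃ q : Torus d m × Torus d m, {ω | edgeWeight p α (fun e => E m e ω) ∈
          {T | 3 + ε ≤ fpp T q.1 q.2 * scaling d m p α}}) := by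
          refine measureReal_mono fun ω hω => ?_
          obtain ⟨q, -, hq⟩ := Finset.exists_mem_eq_sup' Finset.univ_nonempty
            (fun q : Torus d m × Torus d m =>
              transmissionTime (edgeWeight p α fun e => E m e ω) q.1 q.2)
          refine Set.mem_iUnion.mpr ⟨q, ?_⟩
          have h : 3 + ε ≤ diameter (edgeWeight p α fun e => E m e ω) * scaling d m p α := hω
          rw [diameter, hq] at h
          exact h
      _ ≤ ∑ q : Torus d m × Torus d m, C * (((m : ℕ) : ℝ) ^ d) ^ (1 - 3 - ε / 2) := by
          refine (measureReal_iUnion_fintype_le _).trans (Finset.sum_le_sum fun q _ => ?_)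
          rw [measureReal_edgeWeight_mem hp (hind m) (hlaw m)
            (measurableSet_le_fpp_mul _ _ _ _)
            (fun W W' hW h => by rwa [Set.mem_ofPred_eq, ← fpp_congr hW])]
          exact hC' m hm₀ q.1 q.2
      _ = _ := by
          rw [Finset.sum_const, Finset.card_univ, Fintype.card_prod, card_torus, nsmul_eq_mul,
            show -(ε / 2) = 1 + (1 + (1 - 3 - ε / 2)) by ring, Real.rpow_add hn,
            Real.rpow_add hn, Real.rpow_one]
          push_cast
          ring

end Limits

end LRFPP

theorem theorem1p1
    (d : ℕ) (α : ℝ) (hα0 : 0 ≤ α) (hαd : α < d)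
    -- distances on the torus are measured in the `p`-norm
    (p : ℝ≥0∞) (hp : 1 ≤ p)
    {Ω : Type*} [MeasurableSpace Ω] (P : Measure Ω) [IsProbabilityMeasure P]
    -- for every side length `m`, i.i.d. rate-one exponential variables on the edges
    (E : (m : ℕ+) → Sym2 (LRFPP.Torus d m) → Ω → ℝ)
    (hE_indep : ∀ m : ℕ+, iIndepFun (fun e : (LRFPP.graph d m).edgeSet => E m e) P)
    (hE_law : ∀ m : ℕ+, ∀ e ∈ (LRFPP.graph d m).edgeSet, HasLaw (E m e) (expMeasure 1) P) :
    -- typical distance: `(U m, V m)` is a uniform pair of distinct vertices, independent of the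
    -- weights (such pairs exist only for `2 ≤ m`)
    (∀ U V : (m : ℕ+) → Ω → LRFPP.Torus d m,
      (∀ m : ℕ+, 2 ≤ m →
        HasLaw (fun ω => (U m ω, V m ω)) (uniformOn {q | q.1 ≠ q.2}) P) →
      (∀ m : ℕ+, 2 ≤ m →
        IndepFun (fun ω => (U m ω, V m ω))
          (fun ω (e : (LRFPP.graph d m).edgeSet) => E m e ω) P) →
      TendstoInMeasure P
        (fun (m : ℕ+) ω =>
          LRFPP.transmissionTime (LRFPP.edgeWeight p α fun e => E m e ω) (U m ω) (V m ω) *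
            LRFPP.scaling d m p α)
        atTop (fun _ => 1)) ∧
    -- flooding time, from an arbitrary deterministic vertex for every side length
    (∀ u : (m : ℕ+) → LRFPP.Torus d m,
      TendstoInMeasure P
        (fun (m : ℕ+) ω =>
          LRFPP.floodingTime (LRFPP.edgeWeight p α fun e => E m e ω) (u m) *
            LRFPP.scaling d m p α)
        atTop (fun _ => 2)) ∧
    -- diameter
    TendstoInMeasure P
      (fun (m : ℕ+) ω =>
        LRFPP.diameter (LRFPP.edgeWeight p α fun e => E m e ω) * LRFPP.scaling d m p α)
      atTop (fun _ => 3) := by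
  have hd : 0 < d := by
    have h : (0 : ℝ) < d := hα0.trans_lt hαd
    exact_mod_cast h
  exact ⟨fun U V hUV hUVE =>
      LRFPP.tendsto_typical hp hd hα0 hαd hE_indep hE_law hUV hUVE,
    LRFPP.tendsto_flooding hp hd hα0 hαd hE_indep hE_law,
    LRFPP.tendsto_diameter hp hd hα0 hαd hE_indep hE_law⟩
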